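/- Consider the word RAM with word size $w=\Omega(\log n)$: there is a finite set of registers, and instructions (constants, copying, addition, subtraction, comparison with conditional jump, indirect read and write of memory, reading the input, emitting a triple, halting) take one time step each; the memory initially contains arbitrary words. The input is a directed graph $G=(V,E)$, $E\subseteq V\times V$, with $n\ge 1$ vertices (an undirected graph is the special case of a symmetric $E$), given by read-only adjacency lists (in arbitrary order) with constant-time access to $n$, to the degree of each vertex, and to the entries of each list. Degree means number of outgoing edges, $\overline{\Delta}=\frac1n\sum_{v\in V}\deg(v)$ is the average degree, and $d(u,v)\in\{0,1,2,\dots\}\cup\{\infty\}$ is the least number of edges of a directed path from $u$ to $v$, with $d(u,v)=\infty$ if there is none. Theorem. Unweighted no-self-APSD enumeration can be solved without preprocessing, with delay in $O(\overline{\Delta}+1)$ and with space complexity in $\Theta(n)$. That is, there are a fixed program and constants $k,C,A\ge 1$ and $b>0$ such that for all $n\ge1$, all such graphs $G$ with $n$ vertices, all their adjacency lists, every word size $w\ge k\log_2(n+1)$ and every initial content of the memory: 1. the program emits each triple $(u,v,d(u,v))$ with $u,v\in V$, $u\neq v$ exactly once, emits nothing else, and halts; 2. the number of steps from the start to the first output,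 between any two consecutive outputs, and from the last output (or from the start, if there is no output) to the end of the computation is at most $C\cdot(\overline{\Delta}+1)$; 3. the space of the run, in words (the registers and the memory up to the largest address that is used), is at least $b\,n$ and at most $A\,n$. -/

import Mathlib

namespace APSDEnum

/-! ### Graphs and distances -/

/-- `HasWalk G k u v`: there is a directed walk with exactly `k` edge hops from `u` to `v`. -/
inductive HasWalk {V : Type*} (G : Digraph V) : ℕ → V → V → Prop
  | nil (u : V) : HasWalk G 0 u u
  | cons {k : ℕ} {u v x : V} : G.Adj u v → HasWalk G k v x → HasWalk G (k + 1) u x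

/-- The shortest distance: the least number of edge hops from `u` to `v`, and `⊤` (infinity)
if `v` is not reachable from `u`. -/
noncomputable def dist {V : Type*} (G : Digraph V) (u v : V) : ℕ∞ :=
  ⨅ (k : ℕ) (_ : HasWalk G k u v), (k : ℕ∞)

/-- The degree of a vertex: the number of its outgoing edges. -/
noncomputable def outDegree {V : Type*} (G : Digraph V) (v : V) : ℕ :=
  {u | G.Adj v u}.ncard

/-- The average degree of a graph on `n` vertices. -/
noncomputable def avgDegree {n : ℕ} (G : Digraph (Fin n)) : ℝ :=
  (∑ v, (outDegree G v : ℝ)) / n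

/-- Adjacency lists of a graph: for each vertex the list of its out-neighbours, each listed once,
in an arbitrary order. -/
structure AdjLists {n : ℕ} (G : Digraph (Fin n)) where
  list : Fin n → List (Fin n)
  nodup : ∀ v, (list v).Nodup
  mem_iff : ∀ v u, u ∈ list v ↔ G.Adj v u

/-- Length of the adjacency list of the vertex with number `v` (`0` if there is no such vertex). -/
def AdjLists.deg {n : ℕ} {G : Digraph (Fin n)} (L : AdjLists G) (v : ℕ) : ℕ :=
  if h : v < n then (L.list ⟨v, h⟩).length else 0

/-- The number of the vertex at position `i` (counted from `0`) of the adjacency list of the vertex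
with number `v` (`0` if there is no such entry). -/
def AdjLists.nbr {n : ℕ} {G : Digraph (Fin n)} (L : AdjLists G) (v i : ℕ) : ℕ :=
  if h : v < n then (((L.list ⟨v, h⟩)[i]?).map Fin.val).getD 0 else 0

/-- An emitted triple (source, target, distance). -/
abbrev Output : Type := ℕ × ℕ × ℕ∞

/-- `out` lists, exactly once each, the triples `(u, v, d(u, v))` with `u ≠ v`, and nothing else. -/
def IsNoSelfAPSD {n : ℕ} (G : Digraph (Fin n)) (out : List Output) : Prop :=
  out.Nodup ∧
    ∀ x : Output, x ∈ out ↔ ∃ u v : Fin n, u ≠ v ∧ x = ((u : ℕ), (v : ℕ), dist G u v)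

/-! ### The word RAM

A program is a finite control-flow graph: `Q` is the (finite) set of program positions, `R` the
(finite) set of registers. Each instruction names the position(s) at which to continue. Registers
and memory cells hold words, i.e. numbers below `2 ^ w`, where `w` is the word size. -/

/-- Instructions; each takes one time step. -/
inductive Instr (Q R : Type) : Type
  /-- `d := c` -/
  | const (d : R) (c : ℕ) (q : Q)
  /-- `d := a` -/
  | copy (d a : R) (q : Q)
  /-- `d := a + b`, modulo `2 ^ w` -/
  | add (d a b : R) (q : Q)
  /-- `d := max (a - b) 0` -/
  | sub (d a b : R) (q : Q)
  /-- `d := mem[a]` -/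
  | load (d a : R) (q : Q)
  /-- `mem[a] := b` -/
  | store (a b : R) (q : Q)
  /-- `d :=` the number of vertices of the input graph -/
  | size (d : R) (q : Q)
  /-- `d :=` the degree of vertex `v` of the input graph -/
  | deg (d v : R) (q : Q)
  /-- `d :=` entry `i` of the adjacency list of vertex `v` of the input graph -/
  | nbr (d v i : R) (q : Q)
  /-- if `a < b` continue at `q₁`, else at `q₂` -/
  | ifLt (a b : R) (q₁ q₂ : Q)
  /-- if `a = b` continue at `q₁`, else at `q₂` -/
  | ifEq (a b : R) (q₁ q₂ : Q)
  /-- emit the triple `(u, v, d)` -/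
  | emit (u v d : R) (q : Q)
  /-- emit the triple `(u, v, ∞)` -/
  | emitInf (u v : R) (q : Q)
  /-- end of the computation -/
  | halt

structure Program (Q R : Type) where
  start : Q
  code : Q → Instr Q R

/-- Configurations: program position, registers, memory. The input graph is not part of it: it can
only be read. -/
structure Cfg (Q R : Type) where
  pos : Q
  reg : R → ℕ
  mem : ℕ → ℕ

/-- The effect of one time step. -/
inductive StepResult (Q R : Type) : Type
  | silent (c : Cfg Q R)
  | emit (o : Output) (c : Cfg Q R)
  | halted

namespace Program

variable {Q R : Type}

/-- Initially the registers are `0`, while the content `mem₀` of the memory is not under the control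
of the program. -/
def init (M : Program Q R) (mem₀ : ℕ → ℕ) : Cfg Q R :=
  ⟨M.start, fun _ => 0, mem₀⟩

/-- One step of `M` with word size `w` on the input graph given by the adjacency lists `L`. -/
def step [DecidableEq R] (M : Program Q R) (w : ℕ) {n : ℕ} {G : Digraph (Fin n)} (L : AdjLists G)
    (c : Cfg Q R) : StepResult Q R :=
  match M.code c.pos with
  | .const d x q => .silent ⟨q, Function.update c.reg d (x % 2 ^ w), c.mem⟩
  | .copy d a q => .silent ⟨q, Function.update c.reg d (c.reg a), c.mem⟩
  | .add d a b q => .silent ⟨q, Function.update c.reg d ((c.reg a + c.reg b) % 2 ^ w), c.mem⟩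
  | .sub d a b q => .silent ⟨q, Function.update c.reg d (c.reg a - c.reg b), c.mem⟩
  | .load d a q => .silent ⟨q, Function.update c.reg d (c.mem (c.reg a)), c.mem⟩
  | .store a b q => .silent ⟨q, c.reg, Function.update c.mem (c.reg a) (c.reg b)⟩
  | .size d q => .silent ⟨q, Function.update c.reg d n, c.mem⟩
  | .deg d v q => .silent ⟨q, Function.update c.reg d (L.deg (c.reg v)), c.mem⟩
  | .nbr d v i q => .silent ⟨q, Function.update c.reg d (L.nbr (c.reg v) (c.reg i)), c.mem⟩
  | .ifLt a b q₁ q₂ => .silent ⟨if c.reg a < c.reg b then q₁ else q₂, c.reg, c.mem⟩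
  | .ifEq a b q₁ q₂ => .silent ⟨if c.reg a = c.reg b then q₁ else q₂, c.reg, c.mem⟩
  | .emit u v d q => .emit (c.reg u, c.reg v, (c.reg d : ℕ∞)) ⟨q, c.reg, c.mem⟩
  | .emitInf u v q => .emit (c.reg u, c.reg v, ⊤) ⟨q, c.reg, c.mem⟩
  | .halt => .halted

/-- The memory address that the step from configuration `c` reads or writes, if any. -/
def access (M : Program Q R) (c : Cfg Q R) : Option ℕ :=
  match M.code c.pos with
  | .load _ a _ => some (c.reg a)
  | .store a _ _ => some (c.reg a)
  | _ => none

/-- `M` gets from one configuration to another one in exactly `k` steps, none of which emits. -/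
inductive SilentSteps [DecidableEq R] (M : Program Q R) (w : ℕ) {n : ℕ} {G : Digraph (Fin n)}
    (L : AdjLists G) : ℕ → Cfg Q R → Cfg Q R → Prop
  | refl (c : Cfg Q R) : SilentSteps M w L 0 c c
  | head {k : ℕ} {c c' c'' : Cfg Q R} : M.step w L c = .silent c' →
      SilentSteps M w L k c' c'' → SilentSteps M w L (k + 1) c c''

/-- Started in a given configuration, `M` emits exactly the triples of a given list, in this order,
and then halts; the number of steps up to and including the first emission, the number of steps from
each emission up to and including the next one, and the number of steps from the last emission (or,
if there is none, from the start) until the program has come to its end, are all at most `D`. -/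
inductive EmitsWithDelay [DecidableEq R] (M : Program Q R) (w : ℕ) {n : ℕ} {G : Digraph (Fin n)}
    (L : AdjLists G) (D : ℝ) : Cfg Q R → List Output → Prop
  | done {k : ℕ} {c c' : Cfg Q R} : SilentSteps M w L k c c' → M.step w L c' = .halted →
      ((k + 1 : ℕ) : ℝ) ≤ D → EmitsWithDelay M w L D c []
  | next {k : ℕ} {c c' c'' : Cfg Q R} {o : Output} {out : List Output} :
      SilentSteps M w L k c c' → M.step w L c' = .emit o c'' → ((k + 1 : ℕ) : ℝ) ≤ D →
      EmitsWithDelay M w L D c'' out → EmitsWithDelay M w L D c (o :: out)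

/-- The configurations that occur in the run from `c₀`. -/
def Reaches [DecidableEq R] (M : Program Q R) (w : ℕ) {n : ℕ} {G : Digraph (Fin n)}
    (L : AdjLists G) (c₀ c : Cfg Q R) : Prop :=
  Relation.ReflTransGen
    (fun c c' => M.step w L c = .silent c' ∨ ∃ o, M.step w L c = .emit o c') c₀ c

/-- The space of the run from `c₀`, in words: the registers, and the memory cells `0, …, a`, where
`a` is the largest address that the run reads or writes (a cell in between counts even if it is
never used). -/
noncomputable def space [DecidableEq R] [Fintype R] (M : Program Q R) (w : ℕ) {n : ℕ}
    {G : Digraph (Fin n)} (L : AdjLists G) (c₀ : Cfg Q R) : ℕ∞ :=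
  (Fintype.card R : ℕ∞) +
    ⨆ (a : ℕ) (_ : ∃ c, M.Reaches w L c₀ c ∧ M.access c = some a), ((a : ℕ∞) + 1)

end Program

end APSDEnum

/-! Interleave searches with output. While the distances from `s` are being emitted out of one
array, a breadth-first search from `s + 1` fills a second array, and then the two swap roles. A
search costs O(n + m) elementary steps for m edges, and a row has n positions, so O(m/n + 1) search
steps per position suffice. Two arrays and one queue take 3n words.

The difficulty is the start. Fixing the pace requires m, and summing the degrees takes time
proportional to n; the first search also has no earlier row to hide behind. Both are covered by n
triples that need no search: each `u` has a vertex `L.easy u` whose distance is known in constant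
time. It is a neighbour other than `u`, or, if there is none, any other vertex, at distance
infinity. The easy triples of even vertices are emitted during the summation, those of odd vertices
during the search from 0 (row 0), so at least every second position emits. Row `s + 1` then emits
the triples with source `s`, omitting `s` itself and `L.easy s`.

The pace is `L.edges / n + 3` search steps per position, hence at least 2n + m per row: n to clear
the array, since memory is initially arbitrary, and one per queue entry and per edge. A potential Φ
bounds the steps still needed; at Φ = 0 the queue is exhausted and the array is correct
(`BFSInv.holdsDist`).

For the delay, a row from 1 on has only two silent positions, so for n ≥ 3 each such row emits
something. For n = 2 these rows emit nothing, but there are only two of them. For n = 1 the program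
halts at once.

Time, output and addresses are tracked together by `RunsWithin`, proved backwards from the
continuation. The main steps are `runs_search`, `runs_row`, `runs_rows` and `runs_row_zero`;
`isNoSelfAPSD_output` shows that the emitted list is the right one. -/

namespace APSDEnum

namespace Program

/-! ### A backward calculus for output, delay and addresses -/

section RunsWithin

variable {Q R : Type} [DecidableEq R]

/-- From the given configuration the program emits the given list and halts; the first emission (or
the halt) comes within `b` steps, all later gaps are at most `D`, all addresses are at most `S`. -/
inductive RunsWithin (M : Program Q R) (w : ℕ) {n : ℕ} {G : Digraph (Fin n)} (L : AdjLists G)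
    (S D : ℕ) : ℕ → Cfg Q R → List Output → Prop
  | halt {b : ℕ} {c : Cfg Q R} : M.step w L c = .halted → RunsWithin M w L S D (b + 1) c []
  | silent {b : ℕ} {c c' : Cfg Q R} {out : List Output} : M.step w L c = .silent c' →
      (∀ a, M.access c = some a → a ≤ S) → RunsWithin M w L S D b c' out →
      RunsWithin M w L S D (b + 1) c out
  | emit {b : ℕ} {c c' : Cfg Q R} {o : Output} {out : List Output} : M.step w L c = .emit o c' →
      RunsWithin M w L S D D c' out → RunsWithin M w L S D (b + 1) c (o :: out)

variable {M : Program Q R} {w n : ℕ} {G : Digraph (Fin n)} {L : AdjLists G} {S D : ℕ}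

theorem RunsWithin.mono {b b' : ℕ} {c : Cfg Q R} {out : List Output}
    (h : RunsWithin M w L S D b c out) (hb : b ≤ b') : RunsWithin M w L S D b' c out := by
  induction h generalizing b' with
  | halt hs =>
    obtain ⟨e, rfl⟩ : ∃ e, b' = e + 1 := ⟨b' - 1, by omega⟩
    exact .halt hs
  | silent hs ha _ ih =>
    obtain ⟨e, rfl⟩ : ∃ e, b' = e + 1 := ⟨b' - 1, by omega⟩
    exact .silent hs ha (ih (by omega))
  | emit hs h _ =>
    obtain ⟨e, rfl⟩ : ∃ e, b' = e + 1 := ⟨b' - 1, by omega⟩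
    exact .emit hs h

/-- Collects the maximal silent prefix, which ends either in a halt or in an emission. The budget
`b` concerns this prefix only, and after an emission the budget is `D` again; this is why the
induction needs the two cases spelled out. -/
theorem RunsWithin.emitsWithDelay_aux {b : ℕ} {c : Cfg Q R} {out : List Output} {D' : ℝ}
    (h : RunsWithin M w L S D b c out) (hD : (D : ℝ) ≤ D') :
    (∃ k c', M.SilentSteps w L k c c' ∧ k + 1 ≤ b ∧ M.step w L c' = .halted ∧ out = []) ∨
    (∃ k c' c'' o out', M.SilentSteps w L k c c' ∧ k + 1 ≤ b ∧ M.step w L c' = .emit o c'' ∧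
      out = o :: out' ∧ M.EmitsWithDelay w L D' c'' out') := by
  induction h with
  | halt hs => exact .inl ⟨0, _, .refl _, by omega, hs, rfl⟩
  | silent hs _ _ ih =>
    rcases ih with ⟨k, c', h1, h2, h3, h4⟩ | ⟨k, c', c'', o, out', h1, h2, h3⟩
    · exact .inl ⟨k + 1, c', .head hs h1, by omega, h3, h4⟩
    · exact .inr ⟨k + 1, c', c'', o, out', .head hs h1, by omega, h3⟩
  | emit hs _ ih =>
    refine .inr ⟨0, _, _, _, _, .refl _, by omega, hs, rfl, ?_⟩
    rcases ih with ⟨k, c', h1, h2, h3, rfl⟩ | ⟨k, c', c'', o, out', h1, h2, h3, rfl, h5⟩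
    · exact .done h1 h3 (le_trans (by exact_mod_cast h2) hD)
    · exact .next h1 h3 (le_trans (by exact_mod_cast h2) hD) h5

theorem RunsWithin.emitsWithDelay {c : Cfg Q R} {out : List Output} {D' : ℝ}
    (h : RunsWithin M w L S D D c out) (hD : (D : ℝ) ≤ D') : M.EmitsWithDelay w L D' c out := by
  rcases h.emitsWithDelay_aux hD with
    ⟨k, c', h1, h2, h3, rfl⟩ | ⟨k, c', c'', o, out', h1, h2, h3, rfl, h5⟩
  · exact .done h1 h3 (le_trans (by exact_mod_cast h2) hD)
  · exact .next h1 h3 (le_trans (by exact_mod_cast h2) hD) h5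

theorem access_of_step_not_silent {c : Cfg Q R} (h : ∀ c', M.step w L c ≠ .silent c') :
    M.access c = none := by
  unfold step at h
  unfold access
  split <;> simp_all

theorem RunsWithin.access_le {b : ℕ} {c : Cfg Q R} {out : List Output}
    (h : RunsWithin M w L S D b c out) {a : ℕ} (ha : M.access c = some a) : a ≤ S := by
  cases h with
  | halt hs => rw [access_of_step_not_silent (w := w) (L := L) (by simp [hs])] at ha; cases ha
  | silent _ h' _ => exact h' a ha
  | emit hs _ => rw [access_of_step_not_silent (w := w) (L := L) (by simp [hs])] at ha; cases ha

/-- The step function is deterministic, so every configuration of the run occurs in the derivation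
and inherits its address bound. -/
theorem RunsWithin.reaches {b : ℕ} {c c' : Cfg Q R} {out : List Output}
    (h : RunsWithin M w L S D b c out) (hr : M.Reaches w L c c') :
    ∃ b' out', RunsWithin M w L S D b' c' out' := by
  induction hr with
  | refl => exact ⟨_, _, h⟩
  | tail _ hs ih =>
    obtain ⟨b', out', h'⟩ := ih
    cases h' with
    | halt h1 => simp [h1] at hs
    | silent h1 _ h2 =>
      simp only [h1, StepResult.silent.injEq, reduceCtorEq, exists_false, or_false] at hs
      exact ⟨_, _, hs ▸ h2⟩
    | emit h1 h2 =>
      simp only [h1, StepResult.emit.injEq, reduceCtorEq, false_or, exists_eq_left'] at hs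
      exact ⟨_, _, hs ▸ h2⟩

theorem RunsWithin.space_le [Fintype R] {b : ℕ} {c : Cfg Q R} {out : List Output}
    (h : RunsWithin M w L S D b c out) :
    M.space w L c ≤ (Fintype.card R : ℕ∞) + ((S : ℕ∞) + 1) := by
  unfold space
  gcongr
  refine iSup₂_le fun a ⟨c', hr, ha⟩ => ?_
  obtain ⟨b', out', h'⟩ := h.reaches hr
  gcongr
  exact_mod_cast h'.access_le ha

variable {b : ℕ} {out : List Output} {q q' q₁ q₂ : Q} {ρ : R → ℕ} {μ : ℕ → ℕ}

/-- This and the following rules, one per instruction, reduce a run to the run from the next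
configuration. Their side conditions exclude overflow and bound the accessed addresses. -/
theorem RunsWithin.const {d : R} {x : ℕ} (h : M.code q = .const d x q') (hx : x < 2 ^ w)
    (H : RunsWithin M w L S D b ⟨q', Function.update ρ d x, μ⟩ out) :
    RunsWithin M w L S D (b + 1) ⟨q, ρ, μ⟩ out :=
  .silent (by simp [step, h, Nat.mod_eq_of_lt hx]) (by simp [access, h]) H

theorem RunsWithin.copy {d a : R} (h : M.code q = .copy d a q')
    (H : RunsWithin M w L S D b ⟨q', Function.update ρ d (ρ a), μ⟩ out) :
    RunsWithin M w L S D (b + 1) ⟨q, ρ, μ⟩ out :=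
  .silent (by simp [step, h]) (by simp [access, h]) H

theorem RunsWithin.add {d a₁ a₂ : R} (h : M.code q = .add d a₁ a₂ q')
    (hx : ρ a₁ + ρ a₂ < 2 ^ w)
    (H : RunsWithin M w L S D b ⟨q', Function.update ρ d (ρ a₁ + ρ a₂), μ⟩ out) :
    RunsWithin M w L S D (b + 1) ⟨q, ρ, μ⟩ out :=
  .silent (by simp [step, h, Nat.mod_eq_of_lt hx]) (by simp [access, h]) H

theorem RunsWithin.sub {d a₁ a₂ : R} (h : M.code q = .sub d a₁ a₂ q')
    (H : RunsWithin M w L S D b ⟨q', Function.update ρ d (ρ a₁ - ρ a₂), μ⟩ out) :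
    RunsWithin M w L S D (b + 1) ⟨q, ρ, μ⟩ out :=
  .silent (by simp [step, h]) (by simp [access, h]) H

theorem RunsWithin.load {d a : R} (h : M.code q = .load d a q') (ha : ρ a ≤ S)
    (H : RunsWithin M w L S D b ⟨q', Function.update ρ d (μ (ρ a)), μ⟩ out) :
    RunsWithin M w L S D (b + 1) ⟨q, ρ, μ⟩ out :=
  .silent (by simp [step, h]) (by simpa [access, h]) H

theorem RunsWithin.store {a₁ a₂ : R} (h : M.code q = .store a₁ a₂ q') (ha : ρ a₁ ≤ S)
    (H : RunsWithin M w L S D b ⟨q', ρ, Function.update μ (ρ a₁) (ρ a₂)⟩ out) :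
    RunsWithin M w L S D (b + 1) ⟨q, ρ, μ⟩ out :=
  .silent (by simp [step, h]) (by simpa [access, h]) H

theorem RunsWithin.size {d : R} (h : M.code q = .size d q')
    (H : RunsWithin M w L S D b ⟨q', Function.update ρ d n, μ⟩ out) :
    RunsWithin M w L S D (b + 1) ⟨q, ρ, μ⟩ out :=
  .silent (by simp [step, h]) (by simp [access, h]) H

theorem RunsWithin.deg {d v : R} (h : M.code q = .deg d v q')
    (H : RunsWithin M w L S D b ⟨q', Function.update ρ d (L.deg (ρ v)), μ⟩ out) :
    RunsWithin M w L S D (b + 1) ⟨q, ρ, μ⟩ out :=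
  .silent (by simp [step, h]) (by simp [access, h]) H

theorem RunsWithin.nbr {d v i : R} (h : M.code q = .nbr d v i q')
    (H : RunsWithin M w L S D b ⟨q', Function.update ρ d (L.nbr (ρ v) (ρ i)), μ⟩ out) :
    RunsWithin M w L S D (b + 1) ⟨q, ρ, μ⟩ out :=
  .silent (by simp [step, h]) (by simp [access, h]) H

theorem RunsWithin.ifLt {a₁ a₂ : R} (h : M.code q = .ifLt a₁ a₂ q₁ q₂)
    (H₁ : ρ a₁ < ρ a₂ → RunsWithin M w L S D b ⟨q₁, ρ, μ⟩ out)
    (H₂ : ρ a₂ ≤ ρ a₁ → RunsWithin M w L S D b ⟨q₂, ρ, μ⟩ out) :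
    RunsWithin M w L S D (b + 1) ⟨q, ρ, μ⟩ out := by
  by_cases hlt : ρ a₁ < ρ a₂
  · exact .silent (by simp [step, h, hlt]) (by simp [access, h]) (H₁ hlt)
  · exact .silent (by simp [step, h, hlt]) (by simp [access, h]) (H₂ (not_lt.mp hlt))

theorem RunsWithin.ifEq {a₁ a₂ : R} (h : M.code q = .ifEq a₁ a₂ q₁ q₂)
    (H₁ : ρ a₁ = ρ a₂ → RunsWithin M w L S D b ⟨q₁, ρ, μ⟩ out)
    (H₂ : ρ a₁ ≠ ρ a₂ → RunsWithin M w L S D b ⟨q₂, ρ, μ⟩ out) :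
    RunsWithin M w L S D (b + 1) ⟨q, ρ, μ⟩ out := by
  by_cases heq : ρ a₁ = ρ a₂
  · exact .silent (by simp only [step, h, heq]; simp) (by simp [access, h]) (H₁ heq)
  · exact .silent (by simp [step, h, heq]) (by simp [access, h]) (H₂ heq)

theorem RunsWithin.emitFin {u v d : R} {o : Output} (h : M.code q = .emit u v d q')
    (ho : o = (ρ u, ρ v, (ρ d : ℕ∞))) (H : RunsWithin M w L S D D ⟨q', ρ, μ⟩ out) :
    RunsWithin M w L S D (b + 1) ⟨q, ρ, μ⟩ (o :: out) :=
  .emit (by simp [step, h, ho]) H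

theorem RunsWithin.emitInf {u v : R} {o : Output} (h : M.code q = .emitInf u v q')
    (ho : o = (ρ u, ρ v, ⊤)) (H : RunsWithin M w L S D D ⟨q', ρ, μ⟩ out) :
    RunsWithin M w L S D (b + 1) ⟨q, ρ, μ⟩ (o :: out) :=
  .emit (by simp [step, h, ho]) H

theorem RunsWithin.halted (h : M.code q = .halt) :
    RunsWithin M w L S D (b + 1) ⟨q, ρ, μ⟩ [] :=
  .halt (by simp [step, h])

end RunsWithin

end Program

/-! ### Walks and distances -/

section Walks

theorem HasWalk.append {V : Type*} {G : Digraph V} {k l : ℕ} {u v x : V} (h : HasWalk G k u v)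
    (h' : HasWalk G l v x) : HasWalk G (k + l) u x := by
  induction h with
  | nil => simpa using h'
  | cons ha _ ih => rw [Nat.add_right_comm]; exact .cons ha (ih h')

theorem dist_le_of_hasWalk {V : Type*} {G : Digraph V} {k : ℕ} {u v : V} (h : HasWalk G k u v) :
    dist G u v ≤ k := iInf₂_le k h

theorem le_dist_iff {V : Type*} {G : Digraph V} {u v : V} {a : ℕ∞} :
    a ≤ dist G u v ↔ ∀ k, HasWalk G k u v → a ≤ k := le_iInf₂_iff

theorem one_le_dist {V : Type*} {G : Digraph V} {u v : V} (h : u ≠ v) : 1 ≤ dist G u v := by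
  refine le_dist_iff.2 fun k hk => ?_
  cases hk with
  | nil => exact absurd rfl h
  | cons => simp

theorem dist_eq_one {V : Type*} {G : Digraph V} {u v : V} (h : u ≠ v) (ha : G.Adj u v) :
    dist G u v = 1 :=
  le_antisymm (by simpa using dist_le_of_hasWalk (HasWalk.cons ha (.nil v))) (one_le_dist h)

/-- If the only possible edge out of `u` is a self-loop, a walk from `u` never leaves `u`. -/
theorem dist_eq_top_of_no_proper_adj {V : Type*} {G : Digraph V} {u v : V} (h : u ≠ v)
    (ha : ∀ x, G.Adj u x → x = u) : dist G u v = ⊤ := by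
  refine top_le_iff.1 (le_dist_iff.2 fun k hk => ?_)
  exfalso
  induction hk with
  | nil => exact h rfl
  | cons hux _ ih => obtain rfl := ha _ hux; exact ih h ha

end Walks

/-! ### Adjacency lists addressed by vertex numbers -/

section Numbered

variable {n : ℕ} {G : Digraph (Fin n)}

/-- The distance between the vertices with given numbers. -/
noncomputable def distN (G : Digraph (Fin n)) (u v : ℕ) : ℕ∞ :=
  if h : u < n ∧ v < n then dist G ⟨u, h.1⟩ ⟨v, h.2⟩ else 0

/-- A walk between the vertices with given numbers. -/
def WalkN (G : Digraph (Fin n)) (k u v : ℕ) : Prop :=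
  ∃ (hu : u < n) (hv : v < n), HasWalk G k ⟨u, hu⟩ ⟨v, hv⟩

/-- The number of edges. -/
def AdjLists.edges (L : AdjLists G) : ℕ := ∑ v ∈ Finset.range n, L.deg v

theorem AdjLists.nbr_lt_and_adj (L : AdjLists G) {v i : ℕ} (hv : v < n) (hi : i < L.deg v) :
    ∃ h : L.nbr v i < n, G.Adj ⟨v, hv⟩ ⟨L.nbr v i, h⟩ := by
  have hi' : i < (L.list ⟨v, hv⟩).length := by simpa [AdjLists.deg, hv] using hi
  have e : L.nbr v i = ((L.list ⟨v, hv⟩)[i] : ℕ) := by simp [AdjLists.nbr, hv, hi']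
  refine ⟨by rw [e]; exact Fin.is_lt _, ?_⟩
  simp only [e, Fin.eta]
  exact (L.mem_iff _ _).1 (List.getElem_mem _)

theorem AdjLists.nbr_lt (L : AdjLists G) {v i : ℕ} (hv : v < n) (hi : i < L.deg v) :
    L.nbr v i < n := (L.nbr_lt_and_adj hv hi).1

theorem AdjLists.exists_nbr (L : AdjLists G) {v x : Fin n} (h : G.Adj v x) :
    ∃ i < L.deg v, L.nbr v i = x := by
  obtain ⟨i, hi, e⟩ := List.getElem_of_mem ((L.mem_iff v x).2 h)
  exact ⟨i, by simpa [AdjLists.deg] using hi, by simp [AdjLists.nbr, hi, e]⟩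

theorem AdjLists.nbr_injective (L : AdjLists G) {v i j : ℕ} (hv : v < n) (hi : i < L.deg v)
    (hj : j < L.deg v) (h : L.nbr v i = L.nbr v j) : i = j := by
  have hi' : i < (L.list ⟨v, hv⟩).length := by simpa [AdjLists.deg, hv] using hi
  have hj' : j < (L.list ⟨v, hv⟩).length := by simpa [AdjLists.deg, hv] using hj
  refine ((L.nodup ⟨v, hv⟩).getElem_inj_iff (hi := hi') (hj := hj')).1 (Fin.ext ?_)
  simpa [AdjLists.nbr, hv, hi', hj'] using h

theorem AdjLists.deg_le (L : AdjLists G) (v : ℕ) : L.deg v ≤ n := by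
  unfold AdjLists.deg
  split
  · simpa using (L.nodup _).length_le_card
  · omega

theorem AdjLists.outDegree_eq (L : AdjLists G) (v : Fin n) : outDegree G v = L.deg v := by
  have : {u | G.Adj v u} = ((L.list v).toFinset : Set (Fin n)) := by
    ext u; simp [L.mem_iff]
  rw [outDegree, this, Set.ncard_coe_finset, List.toFinset_card_of_nodup (L.nodup v)]
  simp [AdjLists.deg]

theorem AdjLists.avgDegree_eq (L : AdjLists G) : avgDegree G = (L.edges : ℝ) / n := by
  simp [avgDegree, AdjLists.edges, L.outDegree_eq, Finset.sum_range]

theorem AdjLists.edges_le (L : AdjLists G) : L.edges ≤ n * n := by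
  simpa [AdjLists.edges] using
    Finset.sum_le_card_nsmul (Finset.range n) L.deg n fun v _ => L.deg_le v

theorem WalkN.snoc {L : AdjLists G} {k s u i : ℕ} (h : WalkN G k s u) (hi : i < L.deg u) :
    WalkN G (k + 1) s (L.nbr u i) := by
  obtain ⟨hs, hu, h⟩ := h
  obtain ⟨hx, ha⟩ := L.nbr_lt_and_adj hu hi
  exact ⟨hs, hx, h.append (.cons ha (.nil _))⟩

end Numbered

/-! ### Resumable breadth-first search with a step potential -/

section BFS

variable {n : ℕ} {G : Digraph (Fin n)}

/-- State of a breadth-first search from `s` while the distance array is being initialised. -/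
structure ClearInv (L : AdjLists G) (s : ℕ) (dst que : ℕ → ℕ) (ci hd tl ni Φ : ℕ) : Prop where
  src : s < n
  ci_lt : ci < n
  clear : ∀ v < ci, dst v = if v = s then 0 else n
  que_zero : que 0 = s
  hd_eq : hd = 0
  tl_eq : tl = 1
  ni_eq : ni = 0
  pot : n - ci + n + L.edges ≤ Φ

/-- State of a breadth-first search from `s` while the queue is being processed: the entries of the
queue `que` before `hd` are finished, and so are the first `ni` neighbours of entry `hd`. -/
structure ScanInv (L : AdjLists G) (s : ℕ) (dst que : ℕ → ℕ) (ci hd tl ni Φ : ℕ) : Prop where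
  src : s < n
  ci_eq : ci = n
  dst_src : dst s = 0
  hd_le : hd ≤ tl
  dst_le : ∀ v < n, dst v ≤ n
  que_lt : ∀ i < tl, que i < n
  que_inj : ∀ i < tl, ∀ j < tl, que i = que j → i = j
  found : ∀ v < n, dst v < n → ∃ j < tl, que j = v
  le_index : ∀ j < tl, dst (que j) ≤ j
  mono : ∀ i j, i ≤ j → j < tl → dst (que i) ≤ dst (que j)
  near : hd < tl → ∀ j < tl, dst (que j) ≤ dst (que hd) + 1
  walk : ∀ j < tl, WalkN G (dst (que j)) s (que j)
  finished : ∀ j < hd, ∀ k < L.deg (que j),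
    dst (L.nbr (que j) k) < n ∧ dst (L.nbr (que j) k) ≤ dst (que j) + 1
  current : hd < tl → ∀ k < ni,
    dst (L.nbr (que hd) k) < n ∧ dst (L.nbr (que hd) k) ≤ dst (que hd) + 1
  ni_le : hd < tl → ni ≤ L.deg (que hd)
  pot : hd < tl → n + L.edges ≤ Φ + ∑ i ∈ Finset.range hd, (L.deg (que i) + 1) + ni

/-- State of a breadth-first search that is finished after `Φ` more steps. -/
def BFSInv (L : AdjLists G) (s : ℕ) (dst que : ℕ → ℕ) (ci hd tl ni Φ : ℕ) : Prop :=
  ClearInv L s dst que ci hd tl ni Φ ∨ ScanInv L s dst que ci hd tl ni Φ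

/-- The array `dst` holds the distances from `s`, with `n` for infinity. -/
def HoldsDist (G : Digraph (Fin n)) (s : ℕ) (dst : ℕ → ℕ) : Prop :=
  ∀ v < n, distN G s v = if dst v = n then ⊤ else (dst v : ℕ∞)

variable {L : AdjLists G} {s : ℕ} {dst que dst' que' : ℕ → ℕ} {ci hd tl ni Φ : ℕ}

/-- Clearing the last cell establishes the scanning invariant, with the source as the only queue
entry. The new arrays are compared with the old ones only where they matter, because both are
windows into one memory. -/
theorem ClearInv.step (h : ClearInv L s dst que ci hd tl ni Φ)
    (hdst : ∀ v < n, dst' v = if v = ci then (if v = s then 0 else n) else dst v)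
    (hque : que' 0 = que 0) : BFSInv L s dst' que' (ci + 1) hd tl ni (Φ - 1) := by
  obtain ⟨hs, hci, hc, hq, rfl, rfl, rfl, hp⟩ := h
  have hc' : ∀ v < ci + 1, dst' v = if v = s then 0 else n := by
    intro v hv
    rw [hdst v (by omega)]
    split_ifs <;> first | rfl | (rw [hc v (by omega)]; simp [*])
  rcases Nat.lt_or_ge (ci + 1) n with hlt | hge
  · exact .inl ⟨hs, hlt, hc', hque.trans hq, rfl, rfl, rfl, by omega⟩
  · obtain rfl : n = ci + 1 := by omega
    have h0 : que' 0 = s := hque.trans hq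
    have hds : dst' s = 0 := by simp [hc' s hs]
    refine .inr ⟨hs, rfl, hds, by omega, ?_, ?_, ?_, ?_, ?_, ?_, ?_, ?_, ?_, ?_, ?_, ?_⟩
    · intro v hv; rw [hc' v hv]; split_ifs <;> omega
    · intro i hi; obtain rfl : i = 0 := by omega
      omega
    · omega
    · intro v hv hlt
      refine ⟨0, one_pos, ?_⟩
      rw [hc' v hv] at hlt
      split_ifs at hlt with e <;> omega
    · intro j hj; obtain rfl : j = 0 := by omega
      simp [h0, hds]
    · intro i j hij hj
      obtain rfl : j = 0 := by omega
      obtain rfl : i = 0 := by omega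
      rfl
    · intro _ j hj; obtain rfl : j = 0 := by omega
      omega
    · intro j hj; obtain rfl : j = 0 := by omega
      rw [h0, hds]
      exact ⟨hs, hs, .nil _⟩
    · intro j hj; omega
    · intro _ k hk; omega
    · omega
    · intro _; simp; omega

theorem ScanInv.tl_le (h : ScanInv L s dst que ci hd tl ni Φ) : tl ≤ n := by
  have := Finset.card_le_card_of_injOn (s := Finset.range tl) (t := Finset.range n) que
    (fun i hi => by simpa using h.que_lt i (by simpa using hi))
    (fun i hi j hj e => h.que_inj i (by simpa using hi) j (by simpa using hj) e)
  simpa using this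

/-- A vertex already found lies in the queue, and the queue spans at most two consecutive levels
(`near`), so the edge cannot violate the distance bound. -/
theorem ScanInv.known (h : ScanInv L s dst que ci hd tl ni Φ) (hlt : hd < tl)
    (hni : ni < L.deg (que hd)) (hk : dst (L.nbr (que hd) ni) ≠ n) :
    ScanInv L s dst que ci hd tl (ni + 1) (Φ - 1) := by
  have hx := L.nbr_lt (h.que_lt hd hlt) hni
  have hxn : dst (L.nbr (que hd) ni) < n := lt_of_le_of_ne (h.dst_le _ hx) hk
  refine { h with current := ?_, ni_le := fun _ => hni, pot := ?_ }
  · intro _ k hk'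
    rcases Nat.lt_succ_iff_lt_or_eq.1 hk' with hk' | rfl
    · exact h.current hlt k hk'
    · obtain ⟨j, hj, e⟩ := h.found _ hx hxn
      exact ⟨hxn, e ▸ h.near hlt j hj⟩
  · intro _; have := h.pot hlt; omega

/-- The new vertex goes to the end of the queue one level below the head, which preserves
monotonicity and the two-level property. Since a distance never exceeds its queue index, it stays
below `n`, and the value `n` remains free to mean infinity. -/
theorem ScanInv.discover (h : ScanInv L s dst que ci hd tl ni Φ) (hlt : hd < tl)
    (hni : ni < L.deg (que hd)) (hk : dst (L.nbr (que hd) ni) = n)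
    (hdst : ∀ v < n, dst' v = if v = L.nbr (que hd) ni then dst (que hd) + 1 else dst v)
    (hque : ∀ j < tl, que' j = que j) (hnew : que' tl = L.nbr (que hd) ni) :
    ScanInv L s dst' que' ci hd (tl + 1) (ni + 1) (Φ - 1) := by
  set x := L.nbr (que hd) ni with hx_def
  have hx : x < n := L.nbr_lt (h.que_lt hd hlt) hni
  have hne : ∀ j < tl, que j ≠ x := by
    intro j hj e
    have h1 := h.le_index j hj
    have h2 := h.tl_le
    rw [e, hk] at h1
    omega
  have hold : ∀ j < tl, dst' (que j) = dst (que j) := fun j hj => by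
    rw [hdst _ (h.que_lt j hj), if_neg (hne j hj)]
  have hdx : dst' x = dst (que hd) + 1 := by rw [hdst x hx, if_pos rfl]
  have hhd := h.le_index hd hlt
  have htl : tl < n := by
    -- A queue with `n` distinct entries would contain every vertex, including the undiscovered `x`.
    by_contra hcon
    have hsurj : Finset.image que (Finset.range tl) = Finset.range n := by
      refine Finset.eq_of_subset_of_card_le (fun v hv => ?_) ?_
      · obtain ⟨j, hj, rfl⟩ := Finset.mem_image.1 hv
        simpa using h.que_lt j (by simpa using hj)
      · rw [Finset.card_image_of_injOn fun i hi j hj e =>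
          h.que_inj i (by simpa using hi) j (by simpa using hj) e]
        simpa using hcon
    have : x ∈ Finset.image que (Finset.range tl) := by rw [hsurj]; simpa using hx
    obtain ⟨j, hj, e⟩ := Finset.mem_image.1 this
    exact hne j (by simpa using hj) e
  have hle : ∀ v < n, dst v < n → dst' v = dst v := by
    intro v hv hlt'
    rw [hdst v hv, if_neg]
    rintro rfl
    omega
  refine ⟨h.src, h.ci_eq, ?_, by omega, ?_, ?_, ?_, ?_, ?_, ?_, ?_, ?_, ?_, ?_, ?_, ?_⟩
  · rw [hle s h.src (by rw [h.dst_src]; exact Nat.zero_lt_of_lt hx), h.dst_src]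
  · intro v hv
    rw [hdst v hv]
    split_ifs
    · omega
    · exact h.dst_le v hv
  · intro i hi
    rcases Nat.lt_succ_iff_lt_or_eq.1 hi with hi | rfl
    · rw [hque i hi]; exact h.que_lt i hi
    · rw [hnew]; exact hx
  · intro i hi j hj
    rcases Nat.lt_succ_iff_lt_or_eq.1 hi with hi | rfl <;>
      rcases Nat.lt_succ_iff_lt_or_eq.1 hj with hj | rfl
    · rw [hque i hi, hque j hj]; exact h.que_inj i hi j hj
    · rw [hque i hi, hnew]; exact fun e => absurd e (hne i hi)
    · rw [hque j hj, hnew]; exact fun e => absurd e.symm (hne j hj)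
    · exact fun _ => rfl
  · intro v hv hlt'
    by_cases e : v = x
    · exact ⟨tl, by omega, by rw [hnew, e]⟩
    · rw [hdst v hv, if_neg e] at hlt'
      obtain ⟨j, hj, e'⟩ := h.found v hv hlt'
      exact ⟨j, by omega, by rw [hque j hj, e']⟩
  · intro j hj
    rcases Nat.lt_succ_iff_lt_or_eq.1 hj with hj | rfl
    · rw [hque j hj, hold j hj]; exact h.le_index j hj
    · rw [hnew, hdx]; omega
  · intro i j hij hj
    rcases Nat.lt_succ_iff_lt_or_eq.1 hj with hj | rfl
    · rw [hque j hj, hold j hj, hque i (by omega), hold i (by omega)]; exact h.mono i j hij hj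
    · rcases Nat.lt_or_eq_of_le hij with hi | rfl
      · rw [hnew, hdx, hque i hi, hold i hi]; exact h.near hlt i hi
      · exact le_rfl
  · intro _ j hj
    rw [hque hd hlt, hold hd hlt]
    rcases Nat.lt_succ_iff_lt_or_eq.1 hj with hj | rfl
    · rw [hque j hj, hold j hj]; exact h.near hlt j hj
    · rw [hnew, hdx]
  · intro j hj
    rcases Nat.lt_succ_iff_lt_or_eq.1 hj with hj | rfl
    · rw [hque j hj, hold j hj]; exact h.walk j hj
    · rw [hnew, hdx]; exact (h.walk hd hlt).snoc hni
  · intro j hj k hk'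
    have hj' : j < tl := by omega
    rw [hque j hj'] at hk' ⊢
    have hf := h.finished j hj k hk'
    rw [hold j hj', hle _ (L.nbr_lt (h.que_lt j hj') hk') hf.1]
    exact hf
  · intro _ k hk'
    rw [hque hd hlt, hold hd hlt]
    rcases Nat.lt_succ_iff_lt_or_eq.1 hk' with hk' | rfl
    · have hf := h.current hlt k hk'
      rw [hle _ (L.nbr_lt (h.que_lt hd hlt) (by omega)) hf.1]
      exact hf
    · rw [← hx_def, hdx]; exact ⟨by omega, le_rfl⟩
  · intro _; rw [hque hd hlt]; exact hni
  · intro _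
    rw [Finset.sum_congr rfl fun i hi => by rw [hque i (by have := Finset.mem_range.1 hi; omega)]]
    have := h.pot hlt
    omega

theorem ScanInv.advance (h : ScanInv L s dst que ci hd tl ni Φ) (hlt : hd < tl)
    (hni : L.deg (que hd) ≤ ni) : ScanInv L s dst que ci (hd + 1) tl 0 (Φ - 1) := by
  refine { h with hd_le := hlt, near := ?_, finished := ?_, current := ?_, ni_le := ?_, pot := ?_ }
  · intro hlt' j hj
    have h1 := h.near hlt j hj
    have h2 := h.mono hd (hd + 1) (by omega) hlt'
    omega
  · intro j hj k hk
    rcases Nat.lt_succ_iff_lt_or_eq.1 hj with hj | rfl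
    · exact h.finished j hj k hk
    · exact h.current hlt k (by omega)
  · intro _ k hk; omega
  · intro _; omega
  · intro _
    have h1 := h.pot hlt
    have h2 := h.ni_le hlt
    rw [Finset.sum_range_succ]
    omega

/-- Search steps beyond exhaustion do nothing; the potential bound is required only while the queue
is nonempty. -/
theorem ScanInv.idle (h : ScanInv L s dst que ci hd tl ni Φ) (hge : tl ≤ hd) :
    ScanInv L s dst que ci hd tl ni (Φ - 1) :=
  { h with pot := fun hlt => absurd hlt (by omega) }

/-- Each queue entry accounts for its degree plus one step, and entries are distinct, so the total
is at most n + m. If entry `hd` were unfinished with no potential left, the steps done would already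
reach n + m without the final advance of `hd`, exceeding this total. -/
theorem ScanInv.hd_eq (h : ScanInv L s dst que ci hd tl ni 0) : hd = tl := by
  by_contra hcon
  have hlt : hd < tl := lt_of_le_of_ne h.hd_le hcon
  have h1 := h.pot hlt
  have h2 := h.ni_le hlt
  have h3 : ∑ i ∈ Finset.range (hd + 1), (L.deg (que i) + 1) ≤
      ∑ v ∈ Finset.range n, (L.deg v + 1) := by
    rw [← Finset.sum_image (f := fun v => L.deg v + 1) (s := Finset.range (hd + 1)) (g := que)
      (fun i hi j hj e => h.que_inj i (by have := Finset.mem_range.1 hi; omega) j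
        (by have := Finset.mem_range.1 hj; omega) e)]
    refine Finset.sum_le_sum_of_subset fun v hv => ?_
    obtain ⟨j, hj, rfl⟩ := Finset.mem_image.1 hv
    have := Finset.mem_range.1 hj
    simpa using h.que_lt j (by omega)
  rw [Finset.sum_range_succ, Finset.sum_add_distrib (s := Finset.range n)] at h3
  simp only [Finset.sum_const, Finset.card_range, smul_eq_mul, mul_one] at h3
  unfold AdjLists.edges at h1
  omega

/-- With the queue exhausted, every found vertex is finished, so the array grows by at most one
along each edge. This gives the lower bound on distances; the field `walk` gives the upper bound. -/
theorem ScanInv.dst_le_of_hasWalk (h : ScanInv L s dst que ci hd hd ni Φ) {k : ℕ} {u v : Fin n}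
    (hw : HasWalk G k u v) (hu : dst u < n) : dst v < n ∧ dst v ≤ dst u + k := by
  induction hw with
  | nil => exact ⟨hu, le_rfl⟩
  | @cons k u v x ha _ ih =>
    obtain ⟨j, hj, e⟩ := h.found u u.is_lt hu
    obtain ⟨i, hi, e'⟩ := L.exists_nbr ha
    have hf := h.finished j hj i (by rw [e]; exact hi)
    rw [e, e'] at hf
    have := ih hf.1
    exact ⟨this.1, by omega⟩

theorem ScanInv.holdsDist (h : ScanInv L s dst que ci hd tl ni 0) : HoldsDist G s dst := by
  obtain rfl := h.hd_eq
  intro v hv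
  have hs := h.src
  have hds : dst s < n := by rw [h.dst_src]; omega
  rw [distN, dif_pos ⟨hs, hv⟩]
  split_ifs with e
  · refine top_le_iff.1 (le_dist_iff.2 fun k hk => ?_)
    have := (h.dst_le_of_hasWalk hk hds).1
    simp only at this
    omega
  · refine le_antisymm ?_ (le_dist_iff.2 fun k hk => ?_)
    · obtain ⟨j, hj, rfl⟩ := h.found v hv (lt_of_le_of_ne (h.dst_le v hv) e)
      obtain ⟨_, _, hw⟩ := h.walk j hj
      exact dist_le_of_hasWalk hw
    · have := (h.dst_le_of_hasWalk hk hds).2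
      simp only [h.dst_src] at this
      exact_mod_cast (by omega : dst v ≤ k)

/-- While clearing is still in progress the potential is positive, so at 0 only the scanning case
remains. -/
theorem BFSInv.holdsDist (h : BFSInv L s dst que ci hd tl ni 0) : HoldsDist G s dst := by
  rcases h with h | h
  · have := h.pot; have := h.ci_lt; omega
  · exact h.holdsDist

end BFS

/-! ### Triples known without a search -/

section PrecomputedPairs

variable {n : ℕ} {G : Digraph (Fin n)}

/-- The triple of two vertex numbers and their distance. -/
noncomputable def triple (G : Digraph (Fin n)) (u v : ℕ) : Output := (u, v, distN G u v)

/-- The first two entries of the list of `u` contain a neighbour other than `u`. -/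
def AdjLists.HasProper (L : AdjLists G) (u : ℕ) : Prop :=
  0 < L.deg u ∧ (L.nbr u 0 ≠ u ∨ 1 < L.deg u)

open Classical in
/-- A vertex other than `u` whose distance from `u` is known at once: a neighbour of `u`, and if
there is none, any other vertex. -/
noncomputable def AdjLists.easy (L : AdjLists G) (u : ℕ) : ℕ :=
  if L.HasProper u then (if L.nbr u 0 = u then L.nbr u 1 else L.nbr u 0)
  else if u = 0 then 1 else 0

/-- Lists have no repetitions, so a self-loop occupies at most one of the first two entries: looking
at two entries decides whether a proper neighbour exists. -/
theorem AdjLists.easy_spec (L : AdjLists G) {u : ℕ} (hu : u < n) (hn : 2 ≤ n) :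
    L.easy u < n ∧ L.easy u ≠ u ∧
      (L.HasProper u → distN G u (L.easy u) = 1) ∧
      (¬ L.HasProper u → distN G u (L.easy u) = ⊤) := by
  by_cases hp : L.HasProper u
  · have key : ∃ i < L.deg u, L.easy u = L.nbr u i ∧ L.nbr u i ≠ u := by
      unfold AdjLists.easy
      rw [if_pos hp]
      split_ifs with h0
      · have h1 : 1 < L.deg u := hp.2.resolve_left (not_not.2 h0)
        refine ⟨1, h1, rfl, fun h => ?_⟩
        exact absurd (L.nbr_injective hu hp.1 h1 (h0.trans h.symm)) (by omega)
      · exact ⟨0, hp.1, rfl, h0⟩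
    obtain ⟨i, hi, e, hne⟩ := key
    obtain ⟨hx, ha⟩ := L.nbr_lt_and_adj hu hi
    refine ⟨e ▸ hx, e ▸ hne, fun _ => ?_, fun h => absurd hp h⟩
    rw [e, distN, dif_pos ⟨hu, hx⟩]
    exact dist_eq_one (fun h => hne (congrArg Fin.val h).symm) ha
  · have h1 : L.easy u = if u = 0 then 1 else 0 := by rw [AdjLists.easy, if_neg hp]
    have hlt : L.easy u < n := by rw [h1]; split_ifs <;> omega
    have hne : L.easy u ≠ u := by rw [h1]; split_ifs <;> omega
    refine ⟨hlt, hne, fun h => absurd h hp, fun _ => ?_⟩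
    rw [distN, dif_pos ⟨hu, hlt⟩]
    refine dist_eq_top_of_no_proper_adj (fun h => hne (congrArg Fin.val h).symm) fun x hx => ?_
    obtain ⟨i, hi, e⟩ := L.exists_nbr hx
    simp only at hi e
    unfold AdjLists.HasProper at hp
    push Not at hp
    have h2 := hp (by omega)
    obtain rfl : i = 0 := by omega
    -- Here the list has exactly one entry, and it is `u` itself.
    exact Fin.ext (e ▸ h2.1)

end PrecomputedPairs

/-! ### The program -/

/-- The registers. The arrays of `n` words at `cur` and `nxt` hold the distances that are being
emitted and computed, respectively; the queue of the search is at `que`. -/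
inductive Reg
  | n | one | zero | m | quota | t | p | i | r | x | f | g | cur | nxt | que
  | src | ci | hd | tl | ni | a | u | d | y | e
  deriving DecidableEq

instance : Fintype Reg :=
  Fintype.ofSurjective (fun i : Fin 25 => Reg.ofNat i) fun q =>
    ⟨⟨q.ctorIdx, by cases q <;> decide⟩, Reg.ofNat_ctorIdx q⟩

/-- The positions in the computation of `easy`. -/
inductive EasyPos
  | deg | flag | ifEmpty | first | ifSelf | ifSingle | second | unflag | ifZero | one | zero
  deriving DecidableEq

instance : Fintype EasyPos :=
  Fintype.ofSurjective (fun i : Fin 11 => EasyPos.ofNat i) fun q =>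
    ⟨⟨q.ctorIdx, by cases q <;> decide⟩, EasyPos.ofNat_ctorIdx q⟩

set_option synthInstance.maxHeartbeats 1000000 in
set_option synthInstance.maxSize 10000 in
set_option maxRecDepth 10000 in
/-- The program positions. -/
inductive Pos
  | size | one | ifTrivial | nxt | que | source | finish
  | sumTest | sumDeg | sumAdd | sumArg | sumParity | sumKind | sumFin | sumInf | sumFlip | sumInc
  | easy (second : Bool) (q : EasyPos)
  | quota | quotTest | quotSub | quotInc | parity
  | rowTest | swap₁ | swap₂ | swap₃ | initCi | initHd | initTl | initNi | initI
  | iter | iterQuota | tickTest | tickDec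
  | clrTest | clrAddr | clrIfSrc | clrZero | clrInf | clrInc
  | bfsTest | bfsAddr | bfsLoad | bfsDeg | bfsIfNbr | bfsNbr | bfsNi | bfsDstAddr | bfsDst | bfsIfNew
  | newAddr | newLoad | newInc | newStore | newQueAddr | newQue | newTl | advHd | advNi
  | item | itemArg₀ | itemOdd | itemArg | itemSelf | itemEasy | itemKind | itemFin | itemInf
  | itemIfEasy | itemAddr | itemLoad | itemIfInf | itemEmitInf | itemEmitFin | itemFlip | itemInc
  | rowInc | rowSrc | rowIfLt | rowSrcZero | rowStore
  deriving Fintype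

/-- The enumeration program. -/
def enumProgram : Program Pos Reg where
  start := .size
  code
    | .size => .size .n .one
    | .one => .const .one 1 .ifTrivial
    | .ifTrivial => .ifEq .n .one .finish .nxt
    | .nxt => .copy .nxt .n .que
    | .que => .add .que .n .n .source
    | .source => .store .que .src .sumTest
    | .finish => .halt
    -- sum of the degrees, and the easy triples of the even vertices
    | .sumTest => .ifLt .i .n .sumDeg .quota
    | .sumDeg => .deg .d .i .sumAdd
    | .sumAdd => .add .m .m .d .sumArg
    | .sumArg => .copy .x .i .sumParity
    | .sumParity => .ifEq .p .zero (.easy false .deg) .sumFlip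
    | .sumKind => .ifEq .g .one .sumFin .sumInf
    | .sumFin => .emit .x .f .one .sumFlip
    | .sumInf => .emitInf .x .f .sumFlip
    | .sumFlip => .sub .p .one .p .sumInc
    | .sumInc => .add .i .i .one .sumTest
    -- `f := easy x`, with the flag `g` for a finite distance
    | .easy c .deg => .deg .d .x (.easy c .flag)
    | .easy c .flag => .const .g 1 (.easy c .ifEmpty)
    | .easy c .ifEmpty => .ifEq .d .zero (.easy c .unflag) (.easy c .first)
    | .easy c .first => .nbr .f .x .zero (.easy c .ifSelf)
    | .easy c .ifSelf => .ifEq .f .x (.easy c .ifSingle) (if c then .itemEasy else .sumKind)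
    | .easy c .ifSingle => .ifLt .one .d (.easy c .second) (.easy c .unflag)
    | .easy c .second => .nbr .f .x .one (if c then .itemEasy else .sumKind)
    | .easy c .unflag => .const .g 0 (.easy c .ifZero)
    | .easy c .ifZero => .ifEq .x .zero (.easy c .one) (.easy c .zero)
    | .easy c .one => .const .f 1 (if c then .itemEasy else .sumKind)
    | .easy c .zero => .const .f 0 (if c then .itemEasy else .sumKind)
    -- `quota := m / n + 3`
    | .quota => .const .quota 3 .quotTest
    | .quotTest => .ifLt .m .n .parity .quotSub
    | .quotSub => .sub .m .m .n .quotInc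
    | .quotInc => .add .quota .quota .one .quotTest
    | .parity => .const .p 0 .rowTest
    -- rows: row `0` emits the easy triples of the odd vertices, row `s + 1` those with source `s`
    | .rowTest => .ifLt .n .r .finish .swap₁
    | .swap₁ => .copy .a .cur .swap₂
    | .swap₂ => .copy .cur .nxt .swap₃
    | .swap₃ => .copy .nxt .a .initCi
    | .initCi => .const .ci 0 .initHd
    | .initHd => .const .hd 0 .initTl
    | .initTl => .const .tl 1 .initNi
    | .initNi => .const .ni 0 .initI
    | .initI => .const .i 0 .iter
    | .iter => .ifLt .i .n .iterQuota .rowInc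
    | .iterQuota => .copy .t .quota .tickTest
    | .tickTest => .ifEq .t .zero .item .tickDec
    | .tickDec => .sub .t .t .one .clrTest
    -- one step of the search
    | .clrTest => .ifLt .ci .n .clrAddr .bfsTest
    | .clrAddr => .add .a .nxt .ci .clrIfSrc
    | .clrIfSrc => .ifEq .ci .src .clrZero .clrInf
    | .clrZero => .store .a .zero .clrInc
    | .clrInf => .store .a .n .clrInc
    | .clrInc => .add .ci .ci .one .tickTest
    | .bfsTest => .ifLt .hd .tl .bfsAddr .tickTest
    | .bfsAddr => .add .a .que .hd .bfsLoad
    | .bfsLoad => .load .u .a .bfsDeg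
    | .bfsDeg => .deg .d .u .bfsIfNbr
    | .bfsIfNbr => .ifLt .ni .d .bfsNbr .advHd
    | .bfsNbr => .nbr .y .u .ni .bfsNi
    | .bfsNi => .add .ni .ni .one .bfsDstAddr
    | .bfsDstAddr => .add .e .nxt .y .bfsDst
    | .bfsDst => .load .d .e .bfsIfNew
    | .bfsIfNew => .ifEq .d .n .newAddr .tickTest
    | .newAddr => .add .a .nxt .u .newLoad
    | .newLoad => .load .d .a .newInc
    | .newInc => .add .d .d .one .newStore
    | .newStore => .store .e .d .newQueAddr
    | .newQueAddr => .add .a .que .tl .newQue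
    | .newQue => .store .a .y .newTl
    | .newTl => .add .tl .tl .one .tickTest
    | .advHd => .add .hd .hd .one .advNi
    | .advNi => .const .ni 0 .tickTest
    -- the triple of position `i` of row `r`, if any
    | .item => .ifEq .r .zero .itemArg₀ .itemArg
    | .itemArg₀ => .copy .x .i .itemOdd
    | .itemOdd => .ifEq .p .one (.easy true .deg) .itemFlip
    | .itemArg => .sub .x .r .one .itemSelf
    | .itemSelf => .ifEq .i .x .itemFlip (.easy true .deg)
    | .itemEasy => .ifEq .r .zero .itemKind .itemIfEasy
    | .itemKind => .ifEq .g .one .itemFin .itemInf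
    | .itemFin => .emit .x .f .one .itemFlip
    | .itemInf => .emitInf .x .f .itemFlip
    | .itemIfEasy => .ifEq .i .f .itemFlip .itemAddr
    | .itemAddr => .add .a .cur .i .itemLoad
    | .itemLoad => .load .d .a .itemIfInf
    | .itemIfInf => .ifEq .d .n .itemEmitInf .itemEmitFin
    | .itemEmitInf => .emitInf .x .i .itemFlip
    | .itemEmitFin => .emit .x .i .d .itemFlip
    | .itemFlip => .sub .p .one .p .itemInc
    | .itemInc => .add .i .i .one .iter
    | .rowInc => .add .r .r .one .rowSrc
    | .rowSrc => .copy .src .r .rowIfLt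
    | .rowIfLt => .ifLt .r .n .rowStore .rowSrcZero
    | .rowSrcZero => .const .src 0 .rowStore
    | .rowStore => .store .que .src .rowTest

open Program

/-- The registers that the computation of `easy` changes. -/
def Reg.usedByEasy : Reg → Bool
  | .d | .f | .g => true
  | _ => false

/-- The registers that a step of the search changes. -/
def Reg.usedBySearch : Reg → Bool
  | .ci | .hd | .tl | .ni | .a | .u | .d | .y | .e | .t => true
  | _ => false

/-- The constants that the program keeps in registers. -/
structure Consts (n : ℕ) (ρ : Reg → ℕ) : Prop where
  size : ρ .n = n
  one : ρ .one = 1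
  zero : ρ .zero = 0
  que : ρ .que = 2 * n

/-! ### Correctness and cost of the subroutines -/

section Blocks

variable {n w : ℕ} {G : Digraph (Fin n)} {L : AdjLists G} {S D b : ℕ} {out : List Output}
  {ρ : Reg → ℕ} {μ : ℕ → ℕ}

/-- The flag `c` selects the return position, so one proof serves both copies of the code. -/
theorem runs_easy (c : Bool) (hw : 4 * n + 4 ≤ 2 ^ w) (hc : Consts n ρ)
    (H : ∀ ρ' : Reg → ℕ, (∀ q, q.usedByEasy = false → ρ' q = ρ q) → ρ' .f = L.easy (ρ .x) →
      (L.HasProper (ρ .x) → ρ' .g = 1) → (¬ L.HasProper (ρ .x) → ρ' .g = 0) →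
      RunsWithin enumProgram w L S D b ⟨if c then .itemEasy else .sumKind, ρ', μ⟩ out) :
    RunsWithin enumProgram w L S D (b + 10) ⟨.easy c .deg, ρ, μ⟩ out := by
  -- The branch without a proper neighbour is entered from two places, an empty list and a single
  -- self-loop.
  have unflag : ∀ ρ₁ : Reg → ℕ, (∀ q, q.usedByEasy = false → ρ₁ q = ρ q) →
      ¬ L.HasProper (ρ .x) →
      RunsWithin enumProgram w L S D (b + 3) ⟨.easy c .unflag, ρ₁, μ⟩ out := by
    intro ρ₁ h₁ hp
    refine .const rfl (by omega) (.ifEq rfl (fun h => ?_) (fun h => ?_)) <;>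
      simp [h₁ .x rfl, h₁ .zero rfl, hc.zero] at h <;>
      refine .const rfl (by omega) (H _ ?_ ?_ (fun h => absurd h hp) ?_)
    · intro q hq
      cases q <;> first | exact h₁ _ rfl | cases hq
    · simp [AdjLists.easy, h, h ▸ hp]
    · simp
    · intro q hq
      cases q <;> first | exact h₁ _ rfl | cases hq
    · simp [AdjLists.easy, h, hp]
    · simp
  refine .deg rfl (.const rfl (by omega) (.ifEq rfl (fun h => ?_) fun h => .nbr rfl
    (.ifEq rfl (fun h' => .ifLt rfl (fun h'' => .nbr rfl ((H _ ?_ ?_ ?_ ?_).mono (by omega)))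
      fun h'' => (unflag _ ?_ ?_).mono (by omega))
      fun h' => (H _ ?_ ?_ ?_ ?_).mono (by omega))))
  · simp [hc.zero] at h
    refine (unflag _ ?_ ?_).mono (by omega)
    · intro q hq
      cases q <;> first | rfl | cases hq
    · simp [AdjLists.HasProper, h]
  all_goals simp [hc.zero, hc.one] at h h' ⊢
  · intro q hq
    cases q <;> first | rfl | cases hq
  · simp [hc.one] at h''
    have hp : L.HasProper (ρ .x) := ⟨by omega, .inr h''⟩
    simp [AdjLists.easy, hp, h']
  · simp [hc.one] at h''
    exact ⟨by omega, .inr h''⟩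
  · intro q hq
    cases q <;> first | rfl | cases hq
  · simp [hc.one] at h''
    rintro ⟨_, h1 | h1⟩
    · exact h1 h'
    · omega
  · intro q hq
    cases q <;> first | rfl | cases hq
  · have hp : L.HasProper (ρ .x) := ⟨by omega, .inl h'⟩
    simp [AdjLists.easy, hp, h']
  · exact ⟨by omega, .inl h'⟩

/-- The registers and the memory hold the state of a search from `s` into the array at `nxt` which
is finished after at most `Φ` more steps. -/
structure Searching (L : AdjLists G) (s Φ : ℕ) (ρ : Reg → ℕ) (μ : ℕ → ℕ) : Prop
    extends Consts n ρ where
  bases : ρ .cur = 0 ∧ ρ .nxt = n ∨ ρ .cur = n ∧ ρ .nxt = 0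
  src : ρ .src = s
  bfs : BFSInv L s (fun v => μ (ρ .nxt + v)) (fun j => μ (2 * n + j)) (ρ .ci) (ρ .hd) (ρ .tl)
    (ρ .ni) Φ

theorem Searching.of_frame {s Φ Φ' : ℕ} {ρ' : Reg → ℕ} {μ' : ℕ → ℕ} (h : Searching L s Φ ρ μ)
    (hρ : ∀ q, q.usedBySearch = false → ρ' q = ρ q)
    (hb : BFSInv L s (fun v => μ' (ρ .nxt + v)) (fun j => μ' (2 * n + j)) (ρ' .ci) (ρ' .hd)
      (ρ' .tl) (ρ' .ni) Φ') : Searching L s Φ' ρ' μ' where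
  size := (hρ .n rfl).trans h.size
  one := (hρ .one rfl).trans h.one
  zero := (hρ .zero rfl).trans h.zero
  que := (hρ .que rfl).trans h.que
  bases := by rw [hρ .cur rfl, hρ .nxt rfl]; exact h.bases
  src := (hρ .src rfl).trans h.src
  bfs := by rw [hρ .nxt rfl]; exact hb

/-- The bound 20 covers the longest path, the discovery of a vertex. All writes go to the array at
`nxt` or to the queue, so the array being emitted is untouched. -/
theorem runs_search_step {s Φ : ℕ} (hS : 3 * n ≤ S) (hw : 4 * n + 4 ≤ 2 ^ w)
    (h : Searching L s Φ ρ μ)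
    (H : ∀ (ρ' : Reg → ℕ) (μ' : ℕ → ℕ), (∀ q, q.usedBySearch = false → ρ' q = ρ q) →
      ρ' .t = ρ .t → (∀ v < n, μ' (ρ .cur + v) = μ (ρ .cur + v)) → Searching L s (Φ - 1) ρ' μ' →
      RunsWithin enumProgram w L S D b ⟨.tickTest, ρ', μ'⟩ out) :
    RunsWithin enumProgram w L S D (b + 20) ⟨.clrTest, ρ, μ⟩ out := by
  have hN := h.size
  have hone := h.one
  have hzero := h.zero
  have hque := h.que
  have hsrc := h.src
  have hbases := h.bases
  rcases h.bfs with hb | hb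
  · have hci := hb.ci_lt
    have clr : ∀ (ρ₁ : Reg → ℕ) (v : ℕ), (∀ q, q.usedBySearch = false → ρ₁ q = ρ q) →
        ρ₁ .ci = ρ .ci → ρ₁ .hd = ρ .hd → ρ₁ .tl = ρ .tl → ρ₁ .ni = ρ .ni → ρ₁ .t = ρ .t →
        (v = if ρ .ci = s then 0 else n) →
        RunsWithin enumProgram w L S D (b + 1)
          ⟨.clrInc, ρ₁, Function.update μ (ρ .nxt + ρ .ci) v⟩ out := by
      intro ρ₁ v h₁ h₂ h₃ h₄ h₅ h₆ hv
      have hf : ∀ q : Reg, q.usedBySearch = false →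
          Function.update ρ₁ .ci (ρ₁ .ci + ρ₁ .one) q = ρ q := by
        intro q hq
        cases q <;> first | exact h₁ _ rfl | cases hq
      refine .add rfl (by rw [h₂, h₁ .one rfl]; omega) (H _ _ hf ?_ ?_ (h.of_frame hf ?_))
      · simpa using h₆
      · intro v' hv'
        rw [Function.update_of_ne (by omega)]
      · simp only [h₂, h₁ .one rfl, hone, Function.update_self, ne_eq, reduceCtorEq,
          not_false_eq_true, Function.update_of_ne, h₃, h₄, h₅]
        refine hb.step (fun v' hv' => ?_) ?_
        · by_cases e : v' = ρ .ci
          · simp [e, hv]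
          · rw [Function.update_of_ne (by omega), if_neg e]
        · rw [Function.update_of_ne (by omega)]
    refine .ifLt rfl (fun _ => .add rfl (by omega) (.ifEq rfl
      (fun e => .store rfl ?_ (.mono (clr _ _ ?_ rfl rfl rfl rfl rfl ?_) ?_))
      (fun e => .store rfl ?_ (.mono (clr _ _ ?_ rfl rfl rfl rfl rfl ?_) ?_))))
      (fun hge => absurd hge (by omega))
    all_goals simp [hsrc] at e ⊢
    · omega
    · intro q hq
      cases q <;> first | rfl | cases hq
    · simp [e, hzero]
    · omega
    · intro q hq
      cases q <;> first | rfl | cases hq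
    · simp [e, hN]
  · have hci := hb.ci_eq
    have htl := hb.tl_le
    refine .ifLt rfl (fun hlt => absurd hlt (by omega)) fun _ => .ifLt rfl (fun hlt => ?_)
      fun hge => (H ρ μ (fun _ _ => rfl) rfl (fun _ _ => rfl)
        (h.of_frame (fun _ _ => rfl) (.inr (hb.idle hge)))).mono (by omega)
    have hu := hb.que_lt _ hlt
    refine .add rfl (by omega) (.load rfl (by simp; omega) (.deg rfl
      (.ifLt rfl (fun hni => ?_) fun hni => ?_)))
    · simp [hque] at hni
      have hx := L.nbr_lt hu hni
      have hdeg := L.deg_le (μ (2 * n + ρ .hd))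
      refine .nbr rfl (.add rfl ?_ (.add rfl ?_ (.load rfl ?_ (.ifEq rfl (fun hnew => ?_)
        fun hold => ?_))))
      · simp; omega
      · simp [hque]; omega
      · simp [hque]; omega
      · simp [hque, hN, hone] at hnew
        have hle := hb.le_index _ hlt
        refine .add rfl ?_ (.load rfl ?_ (.add rfl ?_ (.store rfl ?_ (.add rfl ?_
          (.store rfl ?_ (.add rfl ?_ (.mono
            (H _ _ ?_ ?_ ?_ (h.of_frame ?_ (.inr ?_))) ?_)))))))
        all_goals simp [hque, hone]
        · omega
        · omega
        · omega
        · omega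
        · omega
        · omega
        · omega
        · intro q hq
          cases q <;> first | rfl | cases hq
        · intro v hv
          rw [Function.update_of_ne (by omega), Function.update_of_ne (by omega)]
        · intro q hq
          cases q <;> first | rfl | cases hq
        · refine hb.discover hlt hni hnew (fun v hv => ?_) (fun j hj => ?_) ?_
          · rw [Function.update_of_ne (by omega)]
            by_cases e : v = L.nbr (μ (2 * n + ρ .hd)) (ρ .ni)
            · simp [e]
            · rw [Function.update_of_ne (by omega), if_neg e]
          · rw [Function.update_of_ne (by omega), Function.update_of_ne (by omega)]
          · simp
      · simp [hque, hN, hone] at hold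
        refine .mono (H _ μ ?_ rfl (fun _ _ => rfl) (h.of_frame ?_ (.inr ?_))) ?_
        · intro q hq
          cases q <;> first | rfl | cases hq
        · intro q hq
          cases q <;> first | rfl | cases hq
        · simpa [hone] using hb.known hlt hni hold
        · omega
    · simp [hque] at hni
      refine .add rfl ?_ (.const rfl (by omega) (.mono (H _ μ ?_ rfl (fun _ _ => rfl)
        (h.of_frame ?_ (.inr ?_))) ?_))
      · simp; omega
      · intro q hq
        cases q <;> first | rfl | cases hq
      · intro q hq
        cases q <;> first | rfl | cases hq
      · simpa [hone] using hb.advance hlt hni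
      · omega

/-- The factor 22 is 20 for a search step plus 2 for the test and decrement of the counter; the last
test gives the extra 1. -/
theorem runs_search {s Φ k : ℕ} (hS : 3 * n ≤ S) (hw : 4 * n + 4 ≤ 2 ^ w)
    (h : Searching L s Φ ρ μ) (ht : ρ .t = k)
    (H : ∀ (ρ' : Reg → ℕ) (μ' : ℕ → ℕ), (∀ q, q.usedBySearch = false → ρ' q = ρ q) →
      (∀ v < n, μ' (ρ .cur + v) = μ (ρ .cur + v)) → Searching L s (Φ - k) ρ' μ' →
      RunsWithin enumProgram w L S D b ⟨.item, ρ', μ'⟩ out) :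
    RunsWithin enumProgram w L S D (b + 22 * k + 1) ⟨.tickTest, ρ, μ⟩ out := by
  induction k generalizing ρ μ Φ with
  | zero =>
    refine .ifEq rfl (fun _ => H ρ μ (fun _ _ => rfl) (fun _ _ => rfl) h) fun hne => ?_
    exact absurd (ht.trans h.zero.symm) hne
  | succ k ih =>
    have hone := h.one
    have hf : ∀ q : Reg, q.usedBySearch = false →
        Function.update ρ .t (ρ .t - ρ .one) q = ρ q := by
      intro q hq
      cases q <;> first | rfl | cases hq
    rw [show b + 22 * (k + 1) + 1 = b + 22 * k + 21 + 1 + 1 by ring]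
    refine .ifEq rfl (fun e => absurd (e.trans h.zero) (by omega)) fun _ => .sub rfl
      ((runs_search_step (b := b + 22 * k + 1) hS hw (h.of_frame hf h.bfs)
        fun ρ' μ' h₁ h₂ h₃ h₄ => ih h₄ ?_ fun ρ'' μ'' h₅ h₆ h₇ => H ρ'' μ'' ?_ ?_ ?_).mono (by omega))
    · simp [hone] at h₂; omega
    · exact fun q hq => (h₅ q hq).trans ((h₁ q hq).trans (hf q hq))
    · intro v hv
      have e : ρ' .cur = ρ .cur := h₁ .cur rfl
      rw [e] at h₆
      exact (h₆ v hv).trans (h₃ v hv)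
    · rwa [Nat.sub_sub, Nat.add_comm 1 k] at h₇

end Blocks

/-- The registers that the emission of one item changes. -/
def Reg.usedByItem : Reg → Bool
  | .x | .f | .g | .a | .d | .p | .i => true
  | _ => false

/-! ### Running one row -/

section Rows

variable {n w : ℕ} {G : Digraph (Fin n)} {L : AdjLists G} {S D b : ℕ} {out : List Output}
  {ρ : Reg → ℕ} {μ : ℕ → ℕ}

/-- The number of steps of the search for each item. -/
def AdjLists.quota (L : AdjLists G) : ℕ := L.edges / n + 3

/-- The source of the search during row `r`. -/
def rowSource (n r : ℕ) : ℕ := if r < n then r else 0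

open Classical in
/-- The triple emitted at position `i` of row `r`, if any. -/
noncomputable def rowItem (L : AdjLists G) (r i : ℕ) : Option Output :=
  if r = 0 then if i % 2 = 1 then some (triple G i (L.easy i)) else none
  else if i = r - 1 ∨ i = L.easy (r - 1) then none else some (triple G (r - 1) i)

/-- The state at position `i` of row `r`, when the search needs at most `Φ` more steps. -/
structure InRow (L : AdjLists G) (r i Φ : ℕ) (ρ : Reg → ℕ) (μ : ℕ → ℕ) : Prop
    extends Searching L (rowSource n r) Φ ρ μ where
  quota : ρ .quota = L.quota
  row : ρ .r = r
  row_le : r ≤ n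
  index : ρ .i = i
  parity : r = 0 → ρ .p = i % 2
  dists : 1 ≤ r → HoldsDist G (r - 1) (fun v => μ (ρ .cur + v))

theorem InRow.of_frame {r i i' Φ : ℕ} {ρ' : Reg → ℕ} (h : InRow L r i Φ ρ μ)
    (hρ : ∀ q, q.usedByItem = false → ρ' q = ρ q) (hi : ρ' .i = i')
    (hp : r = 0 → ρ' .p = i' % 2) : InRow L r i' Φ ρ' μ where
  size := (hρ .n rfl).trans h.size
  one := (hρ .one rfl).trans h.one
  zero := (hρ .zero rfl).trans h.zero
  que := (hρ .que rfl).trans h.que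
  bases := by rw [hρ .cur rfl, hρ .nxt rfl]; exact h.bases
  src := (hρ .src rfl).trans h.src
  bfs := by
    rw [hρ .nxt rfl, hρ .ci rfl, hρ .hd rfl, hρ .tl rfl, hρ .ni rfl]; exact h.bfs
  quota := (hρ .quota rfl).trans h.quota
  row := (hρ .r rfl).trans h.row
  row_le := h.row_le
  index := hi
  parity := hp
  dists := by rw [hρ .cur rfl]; exact h.dists

theorem runs_next {r i Φ : ℕ} (hw : 4 * n + 4 ≤ 2 ^ w) (hin : i < n)
    (h : InRow L r i Φ ρ μ)
    (H : ∀ ρ', InRow L r (i + 1) Φ ρ' μ → RunsWithin enumProgram w L S D b ⟨.iter, ρ', μ⟩ out) :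
    RunsWithin enumProgram w L S D (b + 2) ⟨.itemFlip, ρ, μ⟩ out := by
  have hi := h.index
  have hone := h.one
  refine .sub rfl (.add rfl ?_ (H _ (h.of_frame ?_ ?_ ?_)))
  · simp; omega
  · intro q hq
    cases q <;> first | rfl | cases hq
  · simp [hone, hi]
  · intro h0
    have := h.parity h0
    simp [hone, this]
    omega

/-- An emitting position only has to reach its emission within `c`, as the budget is then `D` again.
A silent position must also pay for the continuation `b`. -/
theorem runs_item {r i Φ c : ℕ} (hS : 3 * n ≤ S) (hw : 4 * n + 4 ≤ 2 ^ w) (hn : 2 ≤ n)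
    (hin : i < n) (h : InRow L r i Φ ρ μ)
    (H : ∀ ρ', InRow L r (i + 1) Φ ρ' μ → RunsWithin enumProgram w L S D b ⟨.iter, ρ', μ⟩ out)
    (hD : b + 2 ≤ D) (hc : rowItem L r i = none → b + 24 ≤ c) (hc' : 24 ≤ c) :
    RunsWithin enumProgram w L S D c ⟨.item, ρ, μ⟩ ((rowItem L r i).toList ++ out) := by
  have hN := h.size
  have hone := h.one
  have hzero := h.zero
  have hrow := h.row
  have hrn := h.row_le
  have hi := h.index
  have hbases := h.bases
  have next : ∀ ρ₁ : Reg → ℕ, (∀ q, q.usedByItem = false → ρ₁ q = ρ q) → ρ₁ .i = ρ .i →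
      ρ₁ .p = ρ .p → RunsWithin enumProgram w L S D (b + 2) ⟨.itemFlip, ρ₁, μ⟩ out := by
    intro ρ₁ h₁ h₂ h₃
    exact runs_next hw hin (h.of_frame h₁ (h₂.trans hi) fun h0 => h₃.trans (h.parity h0)) H
  have next' : ∀ ρ₁ : Reg → ℕ, (∀ q, q.usedByItem = false → ρ₁ q = ρ q) → ρ₁ .i = ρ .i →
      ρ₁ .p = ρ .p → RunsWithin enumProgram w L S D D ⟨.itemFlip, ρ₁, μ⟩ out :=
    fun ρ₁ h₁ h₂ h₃ => (next ρ₁ h₁ h₂ h₃).mono hD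
  have consts : ∀ v, Consts n (Function.update ρ .x v) := fun v => ⟨hN, hone, hzero, h.que⟩
  by_cases h0 : r = 0
  · have hp := h.parity h0
    by_cases hodd : i % 2 = 1
    · have hit : rowItem L r i = some (triple G i (L.easy i)) := by simp [rowItem, h0, hodd]
      obtain ⟨-, -, hfin, hinf⟩ := L.easy_spec hin hn
      rw [hit]
      refine RunsWithin.mono (b := 24) ?_ hc'
      refine .ifEq rfl (fun _ => .copy rfl (.ifEq rfl (fun _ =>
        (runs_easy (b := 3) true hw (consts _) fun ρ' h₁ h₂ h₃ h₄ => ?_).mono (by omega))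
        fun e => absurd ?_ e)) fun e => absurd ?_ e
      · simp [hi] at h₂ h₃ h₄
        have fr : ∀ q, q.usedByItem = false → ρ' q = ρ q := by
          intro q hq
          cases q <;> first | exact h₁ _ rfl | cases hq
        have hx : ρ' .x = i := by rw [h₁ .x rfl]; simpa using hi
        refine .ifEq rfl (fun _ => .ifEq rfl (fun hg => .emitFin rfl ?_ ?_)
          fun hg => .emitInf rfl ?_ ?_) fun e => absurd ?_ e
        · have hp : L.HasProper i := by
            by_contra hp
            have := h₄ hp
            rw [hg, fr .one rfl, hone] at this
            omega
          rw [triple, hfin hp, hx, h₂, fr .one rfl, hone]; rfl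
        · exact next' _ fr (h₁ .i rfl) (h₁ .p rfl)
        · have hp : ¬ L.HasProper i := by
            intro hp
            exact hg ((h₃ hp).trans ((fr .one rfl).trans hone).symm)
          rw [triple, hinf hp, hx, h₂]
        · exact next' _ fr (h₁ .i rfl) (h₁ .p rfl)
        · rw [fr .r rfl, fr .zero rfl, hrow, hzero, h0]
      · simp [hp, hodd, hone]
      · rw [hrow, hzero, h0]
    · have hit : rowItem L r i = none := by simp [rowItem, h0, hodd]
      rw [hit]
      refine RunsWithin.mono (b := b + 24) ?_ (hc hit)
      refine .ifEq rfl (fun _ => .copy rfl (.ifEq rfl (fun e => absurd e ?_)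
        fun e => .mono (next _ ?_ rfl rfl) (by omega))) fun e => absurd ?_ e
      · simp [hp, hodd, hone]
      · intro q hq
        cases q <;> first | rfl | cases hq
      · rw [hrow, hzero, h0]
  · have hs : r - 1 < n := by omega
    have hd := h.dists (by omega) i hin
    have e1 : ¬ ρ .r = ρ .zero := by omega
    by_cases hself : i = r - 1
    · have hit : rowItem L r i = none := by simp [rowItem, h0, hself]
      rw [hit]
      refine RunsWithin.mono (b := b + 24) ?_ (hc hit)
      refine .ifEq rfl (fun e => absurd e e1) fun _ => .sub rfl (.ifEq rfl
        (fun _ => .mono (next _ ?_ rfl rfl) (by omega)) fun e => absurd ?_ e)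
      · intro q hq
        cases q <;> first | rfl | cases hq
      · simp [hrow, hone, hi, hself]
    · have key : ∀ (c' : ℕ) (o : List Output), (∀ ρ' : Reg → ℕ,
          (∀ q, q.usedByItem = false → ρ' q = ρ q) → ρ' .i = ρ .i → ρ' .p = ρ .p →
          ρ' .x = r - 1 → ρ' .f = L.easy (r - 1) →
          RunsWithin enumProgram w L S D c' ⟨.itemIfEasy, ρ', μ⟩ o) →
          RunsWithin enumProgram w L S D (c' + 14) ⟨.item, ρ, μ⟩ o := by
        intro c' o K
        refine .ifEq rfl (fun e => absurd e e1) fun _ => .sub rfl (.ifEq rfl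
          (fun e => absurd e ?_) fun _ =>
          (runs_easy (b := c' + 1) true hw (consts _) fun ρ' h₁ h₂ _ _ => ?_))
        · simpa [hrow, hone, hi] using hself
        · have fr : ∀ q, q.usedByItem = false → ρ' q = ρ q := by
            intro q hq
            cases q <;> first | exact h₁ _ rfl | cases hq
          refine .ifEq rfl (fun e => absurd e ?_) fun _ =>
            K ρ' fr (h₁ .i rfl) (h₁ .p rfl) ?_ ?_
          · rw [fr .r rfl, fr .zero rfl]; exact e1
          · rw [h₁ .x rfl]; simp [hrow, hone]
          · simpa [hrow, hone] using h₂
      by_cases heasy : i = L.easy (r - 1)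
      · have hit : rowItem L r i = none := by simp [rowItem, h0, ← heasy]
        rw [hit]
        refine RunsWithin.mono (key (b + 3) _ fun ρ' fr hi' hp' hx hf => ?_)
          (by have := hc hit; omega)
        refine .ifEq rfl (fun _ => next _ fr hi' hp') fun e => absurd ?_ e
        rw [hi', hf, hi, heasy]
      · have hit : rowItem L r i = some (triple G (r - 1) i) := by
          simp [rowItem, h0, hself, heasy]
        rw [hit]
        refine RunsWithin.mono (key 10 _ fun ρ' fr hi' hp' hx hf => ?_) (by omega)
        refine .ifEq rfl (fun e => absurd e ?_) fun _ => .add rfl ?_ (.load rfl ?_ (.ifEq rfl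
          (fun e => .emitInf rfl ?_ (next' _ ?_ ?_ ?_))
          fun e => .emitFin rfl ?_ (next' _ ?_ ?_ ?_)))
        · rw [hi', hf, hi]; exact heasy
        · rw [fr .cur rfl, hi']; omega
        · simp [fr .cur rfl, hi']; omega
        · simp [fr .cur rfl, hi', hi, fr .n rfl, hN] at e
          simp [triple, hx, hi', hi, hd, e]
        · intro q hq
          cases q <;> first | exact fr _ rfl | cases hq
        · exact hi'
        · exact hp'
        · simp [fr .cur rfl, hi', hi, fr .n rfl, hN] at e
          simp [triple, hx, hi', hi, hd, e, fr .cur rfl]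
        · intro q hq
          cases q <;> first | exact fr _ rfl | cases hq
        · exact hi'
        · exact hp'

theorem runs_iteration {r i c : ℕ} (hS : 3 * n ≤ S) (hw : 4 * n + 4 ≤ 2 ^ w) (hn : 2 ≤ n)
    (hin : i < n) (h : InRow L r i ((n - i) * L.quota) ρ μ)
    (H : ∀ ρ' μ', InRow L r (i + 1) ((n - (i + 1)) * L.quota) ρ' μ' →
      RunsWithin enumProgram w L S D b ⟨.iter, ρ', μ'⟩ out)
    (hD : b + 2 ≤ D) (hc : rowItem L r i = none → b + (22 * L.quota + 27) ≤ c)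
    (hc' : 22 * L.quota + 27 ≤ c) :
    RunsWithin enumProgram w L S D c ⟨.iter, ρ, μ⟩ ((rowItem L r i).toList ++ out) := by
  obtain ⟨e, he⟩ : ∃ e, c = e + 22 * L.quota + 1 + 2 := ⟨c - 22 * L.quota - 3, by omega⟩
  subst he
  have hf : ∀ q : Reg, q.usedBySearch = false →
      Function.update ρ .t (ρ .quota) q = ρ q := by
    intro q hq
    cases q <;> first | rfl | cases hq
  refine .ifLt rfl (fun _ => .copy rfl (runs_search (b := e) (k := L.quota) hS hw
    (h.toSearching.of_frame hf h.bfs) ?_ fun ρ' μ' h₁ h₂ h₃ => ?_)) fun hge => ?_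
  · simpa using h.quota
  · have fr : ∀ q, q.usedBySearch = false → ρ' q = ρ q :=
      fun q hq => (h₁ q hq).trans (hf q hq)
    have hΦ : (n - i) * L.quota - L.quota = (n - (i + 1)) * L.quota := by
      rw [← Nat.sub_sub, Nat.sub_one_mul]
    rw [hΦ] at h₃
    have h' : InRow L r i ((n - (i + 1)) * L.quota) ρ' μ' :=
      { h₃ with
        quota := (fr .quota rfl).trans h.quota
        row := (fr .r rfl).trans h.row
        row_le := h.row_le
        index := (fr .i rfl).trans h.index
        parity := fun h0 => (fr .p rfl).trans (h.parity h0)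
        dists := fun h1 v hv => by
          have e1 := h.dists h1 v hv
          have e2 : μ' (ρ .cur + v) = μ (ρ .cur + v) := h₂ v hv
          simp only [fr .cur rfl, e2]
          exact e1 }
    refine runs_item hS hw hn hin h' (fun ρ'' => H ρ'' μ') hD (fun hnone => ?_) (by omega)
    have := hc hnone
    omega
  · have h1 := h.size
    have h2 := h.index
    omega

/-- The output of row `r` from position `i` on. -/
noncomputable def rowFrom (L : AdjLists G) (r i : ℕ) : List Output :=
  (List.range' i (n - i)).flatMap fun i => (rowItem L r i).toList

/-- `β i` is the time allowed from position `i` to the next output, possibly in a later row. It has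
to drop by the cost of an item only across silent positions. -/
theorem runs_row {r : ℕ} {β : ℕ → ℕ} (hS : 3 * n ≤ S) (hw : 4 * n + 4 ≤ 2 ^ w) (hn : 2 ≤ n)
    (H : ∀ ρ' μ', InRow L r n 0 ρ' μ' →
      RunsWithin enumProgram w L S D b ⟨.rowInc, ρ', μ'⟩ out)
    (hend : b + 1 ≤ β n) (hD : ∀ i < n, β (i + 1) + 2 ≤ D)
    (hnone : ∀ i < n, rowItem L r i = none → β (i + 1) + (22 * L.quota + 27) ≤ β i)
    (hβ : ∀ i < n, 22 * L.quota + 27 ≤ β i) {i : ℕ} (hi : i ≤ n)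
    (h : InRow L r i ((n - i) * L.quota) ρ μ) :
    RunsWithin enumProgram w L S D (β i) ⟨.iter, ρ, μ⟩ (rowFrom L r i ++ out) := by
  obtain ⟨k, hk⟩ : ∃ k, n - i = k := ⟨_, rfl⟩
  induction k generalizing i ρ μ with
  | zero =>
    obtain rfl : i = n := by omega
    refine RunsWithin.mono (b := b + 1) ?_ hend
    have h' : InRow L r i 0 ρ μ := by simpa using h
    simp only [rowFrom, Nat.sub_self, List.range'_zero, List.flatMap_nil, List.nil_append]
    refine .ifLt rfl (fun hlt => ?_) fun _ => H ρ μ h'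
    rw [h.index, h.size] at hlt
    omega
  | succ k ih =>
    have hlt : i < n := by omega
    have e : rowFrom L r i ++ out =
        (rowItem L r i).toList ++ (rowFrom L r (i + 1) ++ out) := by
      unfold rowFrom
      rw [hk, List.range'_succ, show n - (i + 1) = k by omega]
      simp
    rw [e]
    exact runs_iteration hS hw hn hlt h (fun ρ' μ' h' => ih hlt h' (by omega)) (hD i hlt)
      (hnone i hlt) (hβ i hlt)

end Rows

/-! ### Chaining the rows, the quota computation and the degree summation -/

section Phases

variable {n w : ℕ} {G : Digraph (Fin n)} {L : AdjLists G} {S D b : ℕ} {out : List Output}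
  {ρ : Reg → ℕ} {μ : ℕ → ℕ}

theorem HoldsDist.congr {s : ℕ} {dst dst' : ℕ → ℕ} (h : HoldsDist G s dst)
    (e : ∀ v < n, dst' v = dst v) : HoldsDist G s dst' := fun v hv => by
  rw [e v hv]; exact h v hv

/-- One of the three extra steps per position compensates for rounding down; the other two pay for
clearing the array and for the queue entries. -/
theorem AdjLists.le_mul_quota (L : AdjLists G) (hn : 0 < n) :
    n + n + L.edges ≤ n * L.quota := by
  have := Nat.lt_mul_div_succ L.edges hn
  unfold AdjLists.quota
  rw [show n * (L.edges / n + 3) = n * (L.edges / n + 1) + n + n by ring]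
  omega

/-- The state between two rows, before row `r`. -/
structure AtRow (L : AdjLists G) (r : ℕ) (ρ : Reg → ℕ) (μ : ℕ → ℕ) : Prop
    extends Consts n ρ where
  bases : ρ .cur = 0 ∧ ρ .nxt = n ∨ ρ .cur = n ∧ ρ .nxt = 0
  src : ρ .src = rowSource n r
  queue : μ (2 * n) = rowSource n r
  quota : ρ .quota = L.quota
  row : ρ .r = r
  parity : r = 0 → ρ .p = 0
  dists : 1 ≤ r → r ≤ n → HoldsDist G (r - 1) (fun v => μ (ρ .nxt + v))

theorem runs_rowTest {r : ℕ} (hw : 4 * n + 4 ≤ 2 ^ w) (hn : 0 < n) (hr : r ≤ n)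
    (h : AtRow L r ρ μ)
    (H : ∀ ρ', InRow L r 0 (n * L.quota) ρ' μ →
      RunsWithin enumProgram w L S D b ⟨.iter, ρ', μ⟩ out) :
    RunsWithin enumProgram w L S D (b + 9) ⟨.rowTest, ρ, μ⟩ out := by
  have h1 := h.size
  have h2 := h.row
  have h3 := h.bases
  have h4 := h.queue
  have hpos : 0 < 2 ^ w := by omega
  refine .ifLt rfl (fun hlt => absurd hlt (by omega)) fun _ => .copy rfl (.copy rfl (.copy rfl
    (.const rfl hpos (.const rfl hpos (.const rfl (by omega) (.const rfl hpos
      (.const rfl hpos (H _ ?_))))))))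
  exact
    { size := h.size
      one := h.one
      zero := h.zero
      que := h.que
      bases := by simp; omega
      src := h.src
      bfs := by
        refine .inl ⟨?_, hn, fun v hv => absurd hv ?_, ?_, rfl, rfl, rfl, ?_⟩
        · unfold rowSource; split_ifs <;> omega
        · simp
        · simpa using h4
        · simpa using L.le_mul_quota hn
      quota := h.quota
      row := h.row
      row_le := hr
      index := rfl
      parity := h.parity
      dists := fun h1 => by simpa using h.dists h1 hr }

/-- At the end of a row the potential is 0, so the search result is final and becomes the data of
the next row. Row `n` searches from 0 again; that result is never used. -/
theorem runs_rowInc {r : ℕ} (hS : 3 * n ≤ S) (hw : 4 * n + 4 ≤ 2 ^ w) (hn : 0 < n)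
    (h : InRow L r n 0 ρ μ)
    (H : ∀ ρ' μ', AtRow L (r + 1) ρ' μ' →
      RunsWithin enumProgram w L S D b ⟨.rowTest, ρ', μ'⟩ out) :
    RunsWithin enumProgram w L S D (b + 5) ⟨.rowInc, ρ, μ⟩ out := by
  have hsize := h.size
  have hone := h.one
  have hque := h.que
  have hrow := h.row
  have hrn := h.row_le
  have hbases := h.bases
  have store : ∀ ρ₁ : Reg → ℕ, (∀ q, q ≠ .r → q ≠ .src → ρ₁ q = ρ q) → ρ₁ .r = r + 1 →
      ρ₁ .src = rowSource n (r + 1) →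
      RunsWithin enumProgram w L S D (b + 1) ⟨.rowStore, ρ₁, μ⟩ out := by
    intro ρ₁ h₁ h₂ h₃
    have e := h₁ .que (by simp) (by simp)
    have e' := h₁ .nxt (by simp) (by simp)
    refine .store rfl (by omega) (H _ _ ?_)
    exact
      { size := (h₁ .n (by simp) (by simp)).trans hsize
        one := (h₁ .one (by simp) (by simp)).trans hone
        zero := (h₁ .zero (by simp) (by simp)).trans h.zero
        que := e.trans hque
        bases := by rw [e', h₁ .cur (by simp) (by simp)]; exact hbases
        src := h₃
        queue := by rw [e, hque, Function.update_self, h₃]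
        quota := (h₁ .quota (by simp) (by simp)).trans h.quota
        row := h₂
        parity := fun h0 => absurd h0 (by omega)
        dists := fun _ hr => by
          have hd := h.bfs.holdsDist
          rw [rowSource, if_pos (by omega)] at hd
          rw [e, e', hque]
          exact hd.congr fun v hv => by rw [Function.update_of_ne (by omega)] }
  refine .add rfl (by omega) (.copy rfl (.ifLt rfl (fun hlt => .mono (store _ ?_ ?_ ?_) ?_)
    fun hge => .const rfl (by omega) (store _ ?_ ?_ ?_)))
  · intro q h1 h2
    simp [h1, h2]
  · simp [hrow, hone]
  · simp [hrow, hone, hsize] at hlt ⊢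
    simp [rowSource, hlt]
  · omega
  · intro q h1 h2
    simp [h1, h2]
  · simp [hrow, hone]
  · simp [hrow, hone, hsize] at hge ⊢
    simp [rowSource, hge]

/-- The time per item. -/
def AdjLists.itemTime (L : AdjLists G) : ℕ := 22 * L.quota + 27

/-- The time from the start of row `r ≥ 1` to the next output. -/
def AdjLists.rowGap (L : AdjLists G) (r : ℕ) : ℕ :=
  if 3 ≤ n then 3 * L.itemTime + 9 else 3 * L.itemTime * (4 - r)

/-- The output from row `r` on. -/
noncomputable def rowsFrom (L : AdjLists G) (r : ℕ) : List Output :=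
  (List.range' r (n + 1 - r)).flatMap fun r => rowFrom L r 0

theorem rowsFrom_eq {r : ℕ} (hr : r ≤ n) :
    rowsFrom L r = rowFrom L r 0 ++ rowsFrom L (r + 1) := by
  unfold rowsFrom
  rw [show n + 1 - r = (n + 1 - (r + 1)) + 1 by omega, List.range'_succ]
  simp

/-- With n ≥ 3 a row has an emitting position after at most two silent ones, hence three item times.
With n = 2 rows 1 and 2 are silent and their costs accumulate up to the halt. -/
theorem runs_rows (hS : 3 * n ≤ S) (hw : 4 * n + 4 ≤ 2 ^ w) (hn : 2 ≤ n)
    (hD : 16 * L.itemTime ≤ D) {r : ℕ} (h1 : 1 ≤ r) (hr : r ≤ n + 1) (h : AtRow L r ρ μ) :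
    RunsWithin enumProgram w L S D (L.rowGap r) ⟨.rowTest, ρ, μ⟩ (rowsFrom L r) := by
  have hE : 27 ≤ L.itemTime := by unfold AdjLists.itemTime; omega
  obtain ⟨k, hk⟩ : ∃ k, n + 1 - r = k := ⟨_, rfl⟩
  induction k generalizing r ρ μ with
  | zero =>
    obtain rfl : r = n + 1 := by omega
    refine RunsWithin.mono (b := 2) ?_ ?_
    · simp only [rowsFrom, Nat.sub_self, List.range'_zero, List.flatMap_nil]
      refine .ifLt rfl (fun _ => .halted rfl) fun hge => ?_
      have e1 := h.size
      have e2 := h.row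
      omega
    · unfold AdjLists.rowGap
      split_ifs
      · omega
      · obtain rfl : n = 2 := by omega
        omega
  | succ k ih =>
    have hrn : r ≤ n := by omega
    have hs : r - 1 < n := by omega
    obtain ⟨hlt, hne, -, -⟩ := L.easy_spec hs hn
    rw [rowsFrom_eq hrn]
    obtain ⟨hle, hge, hgap⟩ : L.rowGap (r + 1) ≤ 9 * L.itemTime ∧
        L.itemTime ≤ L.rowGap (r + 1) ∧ (if 3 ≤ n then L.rowGap r = 3 * L.itemTime + 9
          else L.rowGap r = L.rowGap (r + 1) + 3 * L.itemTime) := by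
      unfold AdjLists.rowGap
      split_ifs
      · omega
      · obtain rfl | rfl : r = 1 ∨ r = 2 := by omega
        all_goals omega
    -- A position certain to emit: one of 0, 1, 2 avoids the two silent positions.
    obtain ⟨l, hl⟩ : ∃ l : ℕ, 3 ≤ n → l < n ∧ l ≠ r - 1 ∧ l ≠ L.easy (r - 1) := by
      by_contra hcon
      push Not at hcon
      have a0 := hcon 0
      have a1 := hcon 1
      have a2 := hcon 2
      omega
    -- One item time for each silent position not yet passed. On top, either one for the item at
    -- `l`, if that is still ahead, or the whole gap of the next row, with 6 steps for the final
    -- loop test and the change of row.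
    let β : ℕ → ℕ := fun i => (if i ≤ r - 1 then L.itemTime else 0) +
      (if i ≤ L.easy (r - 1) then L.itemTime else 0) +
      (if 3 ≤ n ∧ i ≤ l then L.itemTime else L.rowGap (r + 1) + 6)
    have start : β 0 + 9 ≤ L.rowGap r := by
      simp only [β, Nat.zero_le, if_true, and_true]
      split_ifs at hgap ⊢ <;> omega
    refine RunsWithin.mono (runs_rowTest hw (by omega) hrn h fun ρ' h' =>
      runs_row (β := β) hS hw hn (fun ρ₁ μ₁ h₁ => runs_rowInc hS hw (by omega) h₁ fun ρ₂ μ₂ h₂ =>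
        ih (by omega) (by omega) h₂ (by omega)) ?_ ?_ ?_ ?_ (Nat.zero_le n) h') start
    · simp only [β]
      rw [if_neg (c := 3 ≤ n ∧ n ≤ l) (by omega)]
      omega
    · intro i _
      simp only [β]
      split_ifs <;> omega
    · intro i _ hnone
      have hi : i = r - 1 ∨ i = L.easy (r - 1) := by
        by_contra hcon
        simp [rowItem, show r ≠ 0 by omega, hcon] at hnone
      change β (i + 1) + L.itemTime ≤ β i
      simp only [β]
      split_ifs <;> omega
    · intro i _
      change L.itemTime ≤ β i
      simp only [β]
      split_ifs <;> omega

theorem runs_row_zero (hS : 3 * n ≤ S) (hw : 4 * n + 4 ≤ 2 ^ w) (hn : 2 ≤ n)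
    (hD : 16 * L.itemTime ≤ D) (h : AtRow L 0 ρ μ) :
    RunsWithin enumProgram w L S D (12 * L.itemTime) ⟨.rowTest, ρ, μ⟩ (rowsFrom L 0) := by
  have hE : 27 ≤ L.itemTime := by unfold AdjLists.itemTime; omega
  have hle : L.rowGap 1 ≤ 9 * L.itemTime := by
    unfold AdjLists.rowGap
    split_ifs <;> omega
  -- Even positions of row 0 are silent and need one additional item time. The rest also covers the
  -- passage to row 1.
  let β : ℕ → ℕ := fun i => L.rowGap 1 + 6 + L.itemTime + (1 - i % 2) * L.itemTime
  have hβ : ∀ i, β i = L.rowGap 1 + 6 + L.itemTime ∧ i % 2 = 1 ∨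
      β i = L.rowGap 1 + 6 + 2 * L.itemTime ∧ i % 2 = 0 := by
    intro i
    rcases Nat.mod_two_eq_zero_or_one i with e | e
    · exact .inr ⟨by simp only [β, e, Nat.sub_zero]; omega, e⟩
    · exact .inl ⟨by simp [β, e], e⟩
  rw [rowsFrom_eq (Nat.zero_le n)]
  refine RunsWithin.mono (runs_rowTest hw (by omega) (Nat.zero_le n) h fun ρ' h' =>
    runs_row (β := β) hS hw hn (fun ρ₁ μ₁ h₁ => runs_rowInc hS hw (by omega) h₁ fun ρ₂ μ₂ h₂ =>
      runs_rows hS hw hn hD (by omega) (by omega) h₂) ?_ ?_ ?_ ?_ (Nat.zero_le n) h') ?_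
  · have := hβ n
    rw [Nat.zero_add]
    omega
  · intro i _; have := hβ (i + 1); omega
  · intro i _ hnone
    have hi : i % 2 ≠ 1 := fun e => by simp [rowItem, e] at hnone
    change β (i + 1) + L.itemTime ≤ β i
    have := hβ (i + 1)
    have := hβ i
    omega
  · intro i _
    change L.itemTime ≤ β i
    have := hβ i
    omega
  · have := hβ 0
    omega

/-- The state before the first row, except for the registers that the computation of the quota
uses. -/
structure BeforeRows (n : ℕ) (ρ : Reg → ℕ) (μ : ℕ → ℕ) : Prop extends Consts n ρ where
  cur : ρ .cur = 0
  nxt : ρ .nxt = n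
  src : ρ .src = 0
  row : ρ .r = 0
  queue : μ (2 * n) = 0

/-- There is no division instruction; repeated subtraction takes `k = L.edges / n` rounds, which is
itself within the allowed delay. -/
theorem runs_quotient {k : ℕ} (hw : 4 * n + 4 ≤ 2 ^ w) (hn : 0 < n) (h : BeforeRows n ρ μ)
    (hk : ρ .m / n = k) (hq : ρ .quota + k = L.quota)
    (H : ∀ ρ', AtRow L 0 ρ' μ → RunsWithin enumProgram w L S D b ⟨.rowTest, ρ', μ⟩ out) :
    RunsWithin enumProgram w L S D (b + 3 * k + 2) ⟨.quotTest, ρ, μ⟩ out := by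
  have hN := h.size
  have hone := h.one
  -- Keeps the growing quota below the word bound.
  have hL : L.quota ≤ n + 3 := by
    have := Nat.div_le_of_le_mul L.edges_le
    unfold AdjLists.quota
    omega
  induction k generalizing ρ with
  | zero =>
    have hlt := (Nat.div_eq_zero_iff_lt hn).1 hk
    refine .ifLt rfl (fun _ => .const rfl (by omega) (H _ ?_)) fun hge => absurd hge (by omega)
    exact
      { size := hN
        one := hone
        zero := h.zero
        que := h.que
        bases := .inl ⟨h.cur, h.nxt⟩
        src := by simp [rowSource, h.src]
        queue := by simp [rowSource, h.queue]
        quota := hq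
        row := h.row
        parity := fun _ => rfl
        dists := fun h1 => absurd h1 (by omega) }
  | succ k ih =>
    have hge : n ≤ ρ .m := by
      by_contra hlt
      rw [Nat.div_eq_of_lt (by omega)] at hk
      omega
    rw [show b + 3 * (k + 1) + 2 = b + 3 * k + 2 + 1 + 1 + 1 by ring]
    refine .ifLt rfl (fun hlt => absurd hlt (by omega)) fun _ => .sub rfl (.add rfl ?_
      (ih ?_ ?_ ?_ ?_ ?_))
    · simp; omega
    · exact { h with }
    · rw [Nat.div_eq_sub_div hn hge] at hk
      simpa [hN] using hk
    · simp [hone]; omega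
    · exact hN
    · exact hone

/-- The state at position `i` of the summation of the degrees. -/
structure Summing (L : AdjLists G) (i : ℕ) (ρ : Reg → ℕ) (μ : ℕ → ℕ) : Prop
    extends BeforeRows n ρ μ where
  index : ρ .i = i
  sum : ρ .m = ∑ j ∈ Finset.range i, L.deg j
  parity : ρ .p = i % 2

/-- The output of the summation of the degrees from position `i` on. -/
noncomputable def sumFrom (L : AdjLists G) (i : ℕ) : List Output :=
  (List.range' i (n - i)).flatMap fun i =>
    (if i % 2 = 0 then some (triple G i (L.easy i)) else none).toList

theorem AdjLists.sum_deg_le (L : AdjLists G) {i : ℕ} (hi : i ≤ n) :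
    ∑ j ∈ Finset.range i, L.deg j ≤ n * n :=
  (Finset.sum_le_sum_of_subset (Finset.range_mono hi)).trans L.edges_le

theorem runs_sum_step {i c : ℕ} (hw : 4 * n + 4 ≤ 2 ^ w) (hw' : n * n < 2 ^ w) (hn : 2 ≤ n)
    (hi : i < n) (h : Summing L i ρ μ)
    (H : ∀ ρ', Summing L (i + 1) ρ' μ →
      RunsWithin enumProgram w L S D b ⟨.sumTest, ρ', μ⟩ out)
    (hD : b + 2 ≤ D) (hc : i % 2 = 1 → b + 20 ≤ c) (hc' : 20 ≤ c) :
    RunsWithin enumProgram w L S D c ⟨.sumTest, ρ, μ⟩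
      ((if i % 2 = 0 then some (triple G i (L.easy i)) else none).toList ++ out) := by
  have hN := h.size
  have hone := h.one
  have hzero := h.zero
  have hidx := h.index
  have hsum := h.sum
  have hp := h.parity
  have hle : ρ .m + L.deg i ≤ n * n := by
    rw [hsum, ← Finset.sum_range_succ]
    exact L.sum_deg_le hi
  have next : ∀ ρ₁ : Reg → ℕ, (∀ q, q.usedByItem = false → q ≠ .m → ρ₁ q = ρ q) →
      ρ₁ .i = ρ .i → ρ₁ .p = ρ .p → ρ₁ .m = ρ .m + L.deg i →
      RunsWithin enumProgram w L S D (b + 2) ⟨.sumFlip, ρ₁, μ⟩ out := by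
    intro ρ₁ h₁ h₂ h₃ h₄
    have e := h₁ .one rfl (by simp)
    refine .sub rfl (.add rfl (by simp; omega) (H _ ?_))
    exact
      { size := (h₁ .n rfl (by simp)).trans hN
        one := e.trans hone
        zero := (h₁ .zero rfl (by simp)).trans hzero
        que := (h₁ .que rfl (by simp)).trans h.que
        cur := (h₁ .cur rfl (by simp)).trans h.cur
        nxt := (h₁ .nxt rfl (by simp)).trans h.nxt
        src := (h₁ .src rfl (by simp)).trans h.src
        row := (h₁ .r rfl (by simp)).trans h.row
        queue := h.queue
        index := by simp [e, h₂, hone, hidx]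
        sum := by simp [h₄, hsum, Finset.sum_range_succ]
        parity := by simp [e, h₃, hone, hp]; omega }
  have hm : ∀ q : Reg, q.usedByItem = false → q ≠ .m →
      Function.update (Function.update (Function.update ρ .d (L.deg (ρ .i))) .m
        (ρ .m + L.deg (ρ .i))) .x (ρ .i) q = ρ q := by
    intro q hq hq'
    cases q <;> first | rfl | exact absurd rfl hq' | cases hq
  have key : ∀ (c' : ℕ) (o : List Output),
      RunsWithin enumProgram w L S D c' ⟨.sumParity,
        Function.update (Function.update (Function.update ρ .d (L.deg (ρ .i))) .m
          (ρ .m + L.deg (ρ .i))) .x (ρ .i), μ⟩ o →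
      RunsWithin enumProgram w L S D (c' + 4) ⟨.sumTest, ρ, μ⟩ o := by
    intro c' o K
    refine .ifLt rfl (fun _ => .deg rfl (.add rfl ?_ (.copy rfl K)))
      fun hge => absurd hge (by omega)
    simp [hidx]
    omega
  by_cases heven : i % 2 = 0
  · obtain ⟨-, -, hfin, hinf⟩ := L.easy_spec hi hn
    rw [if_pos heven]
    refine RunsWithin.mono (b := 20) (key 16 _ ?_) hc'
    refine .ifEq rfl (fun _ => runs_easy (b := 5) false hw ?_ fun ρ' h₁ h₂ h₃ h₄ => ?_)
      fun e => absurd ?_ e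
    · exact ⟨hN, hone, hzero, h.que⟩
    · simp [hidx] at h₂ h₃ h₄
      have fr : ∀ q, q.usedByItem = false → q ≠ .m → ρ' q = ρ q := by
        intro q hq hq'
        cases q <;> first | exact absurd rfl hq' | exact h₁ _ rfl | cases hq
      have fi : ρ' .i = ρ .i := h₁ .i rfl
      have fp : ρ' .p = ρ .p := h₁ .p rfl
      have fm : ρ' .m = ρ .m + L.deg i := by rw [h₁ .m rfl]; simp [hidx]
      have fone : ρ' .one = 1 := (fr .one rfl (by simp)).trans hone
      have hx : ρ' .x = i := by rw [h₁ .x rfl]; simpa using hidx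
      refine .ifEq rfl (fun hg => .emitFin rfl ?_ (.mono (next _ fr fi fp fm) hD))
        fun hg => .emitInf rfl ?_ (.mono (next _ fr fi fp fm) hD)
      · have hp : L.HasProper i := by
          by_contra hp
          have := h₄ hp
          omega
        rw [triple, hfin hp, hx, h₂, fone]; rfl
      · have hp : ¬ L.HasProper i := fun hp => hg ((h₃ hp).trans fone.symm)
        rw [triple, hinf hp, hx, h₂]
    · simp [hp, heven, hzero]
  · rw [if_neg heven]
    refine RunsWithin.mono (b := b + 2 + 1 + 4) (key _ _ ?_) (by have := hc (by omega); omega)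
    refine .ifEq rfl (fun e => absurd e ?_) fun _ => next _ hm rfl rfl (by simp [hidx])
    simp [hp, hzero]; omega

/-- Odd positions are silent, hence the additional 20 in their budget; `b` is what remains to be
done after the summation. -/
theorem runs_sum (hw : 4 * n + 4 ≤ 2 ^ w) (hw' : n * n < 2 ^ w) (hn : 2 ≤ n)
    (H : ∀ ρ', Summing L n ρ' μ → RunsWithin enumProgram w L S D b ⟨.quota, ρ', μ⟩ out)
    (hD : b + 43 ≤ D) {i : ℕ} (hi : i ≤ n) (h : Summing L i ρ μ) :
    RunsWithin enumProgram w L S D (b + 21 + (i % 2) * 20) ⟨.sumTest, ρ, μ⟩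
      (sumFrom L i ++ out) := by
  obtain ⟨k, hk⟩ : ∃ k, n - i = k := ⟨_, rfl⟩
  induction k generalizing i ρ with
  | zero =>
    obtain rfl : i = n := by omega
    refine RunsWithin.mono (b := b + 1) ?_ (by omega)
    simp only [sumFrom, Nat.sub_self, List.range'_zero, List.flatMap_nil, List.nil_append]
    refine .ifLt rfl (fun hlt => ?_) fun _ => H ρ h
    rw [h.index, h.size] at hlt
    omega
  | succ k ih =>
    have hlt : i < n := by omega
    have e : sumFrom L i ++ out =
        (if i % 2 = 0 then some (triple G i (L.easy i)) else none).toList ++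
          (sumFrom L (i + 1) ++ out) := by
      unfold sumFrom
      rw [hk, List.range'_succ, show n - (i + 1) = k by omega]
      simp
    rw [e]
    exact runs_sum_step hw hw' hn hlt h (fun ρ' h' => ih hlt h' (by omega)) (by omega) (by omega)
      (by omega)

theorem runs_enumProgram (hS : 3 * n ≤ S) (hw : 4 * n + 4 ≤ 2 ^ w) (hw' : n * n < 2 ^ w)
    (hn : 2 ≤ n) (hD : 16 * L.itemTime ≤ D) (mem₀ : ℕ → ℕ) :
    RunsWithin enumProgram w L S D D (enumProgram.init mem₀)
      (sumFrom L 0 ++ rowsFrom L 0) := by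
  have hq : 22 * L.quota + 27 = L.itemTime := rfl
  obtain ⟨k, hk, hk'⟩ : ∃ k, L.edges / n = k ∧ L.quota = k + 3 := ⟨_, rfl, rfl⟩
  -- The gap for row 0, then the quotient, the slack of the summation and the six initial
  -- instructions; together they stay below 16 item times.
  refine RunsWithin.mono (b := (12 * L.itemTime + 3 * k + 2 + 1) + 21 + 6) ?_ ?_
  · refine .size rfl (.const rfl (by omega) (.ifEq rfl (fun e => absurd e ?_) fun _ => .copy rfl
      (.add rfl ?_ (.store rfl ?_ (runs_sum (i := 0) hw hw' hn (fun ρ' h' => ?_) ?_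
        (Nat.zero_le n) ?_)))))
    · simp; omega
    · simp; omega
    · simp; omega
    · have hm : ρ' .m = L.edges := h'.sum
      refine .const rfl (by omega) (runs_quotient (L := L) (k := k) hw (by omega)
        { h'.toBeforeRows with } ?_ ?_ fun ρ'' h'' => runs_row_zero hS hw hn hD h'')
      · simp [hm, hk]
      · simp [hk', Nat.add_comm]
    · omega
    · exact
        { size := rfl
          one := rfl
          zero := rfl
          que := by simp; omega
          cur := rfl
          nxt := rfl
          src := rfl
          row := rfl
          queue := by
            have e : n + n = 2 * n := by omega
            simp [e]
          index := rfl
          sum := rfl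
          parity := rfl }
  · omega

end Phases

/-! ### The emitted list, the lower space bound and the theorem -/

section Main

variable {n w : ℕ} {G : Digraph (Fin n)} {L : AdjLists G}

theorem nodup_flatMap_of_disjoint {α β : Type*} {l : List α} {f : α → List β} (hl : l.Nodup)
    (hf : ∀ a ∈ l, (f a).Nodup) (hd : ∀ a ∈ l, ∀ a' ∈ l, ∀ x, x ∈ f a → x ∈ f a' → a = a') :
    (l.flatMap f).Nodup := by
  refine List.nodup_flatMap.2 ⟨hf, hl.imp_of_mem fun {a a'} ha ha' hne => ?_⟩
  exact fun x hx hx' => hne (hd a ha a' ha' x hx hx')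

theorem triple_inj {u v u' v' : ℕ} (h : triple G u v = triple G u' v') : u = u' ∧ v = v' := by
  simp only [triple, Prod.mk.injEq] at h
  exact ⟨h.1, h.2.1⟩

theorem mem_sumFrom {x : Output} :
    x ∈ sumFrom L 0 ↔ ∃ i < n, i % 2 = 0 ∧ x = triple G i (L.easy i) := by
  simp only [sumFrom, Nat.sub_zero, List.mem_flatMap, List.mem_range'_1, Option.mem_toList]
  refine exists_congr fun i => ?_
  split_ifs with h <;> simp [h, eq_comm]

theorem mem_rowFrom_zero {x : Output} :
    x ∈ rowFrom L 0 0 ↔ ∃ i < n, i % 2 = 1 ∧ x = triple G i (L.easy i) := by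
  simp only [rowFrom, Nat.sub_zero, List.mem_flatMap, List.mem_range'_1, Option.mem_toList,
    rowItem, if_true]
  refine exists_congr fun i => ?_
  split_ifs with h <;> simp [h, eq_comm]

theorem mem_rowFrom_succ {s : ℕ} {x : Output} :
    x ∈ rowFrom L (s + 1) 0 ↔ ∃ i < n, ¬ (i = s ∨ i = L.easy s) ∧ x = triple G s i := by
  simp only [rowFrom, Nat.sub_zero, List.mem_flatMap, List.mem_range'_1, Option.mem_toList,
    rowItem, Nat.add_one_ne_zero, if_false, Nat.add_sub_cancel]
  refine exists_congr fun i => ?_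
  by_cases h : i = s ∨ i = L.easy s
  · simp only [not_true_eq_false, h]; simp
  · simp only [not_false_eq_true, h]; simp [eq_comm]

/-- The position is recovered from the source in row 0 and from the target in the other rows. -/
theorem rowItem_inj {r i i' : ℕ} {x : Output} (h : rowItem L r i = some x)
    (h' : rowItem L r i' = some x) : i = i' := by
  unfold rowItem at h h'
  split_ifs at h h' <;> simp only [Option.some.injEq] at h h'
  · exact (triple_inj (h.trans h'.symm)).1
  · exact (triple_inj (h.trans h'.symm)).2

theorem nodup_rowFrom (r : ℕ) : (rowFrom L r 0).Nodup := by
  refine nodup_flatMap_of_disjoint List.nodup_range' (fun i _ => ?_) fun i _ i' _ x h h' => ?_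
  · cases rowItem L r i <;> simp
  · rw [Option.mem_toList] at h h'
    exact rowItem_inj h h'

theorem nodup_sumFrom : (sumFrom L 0).Nodup := by
  refine nodup_flatMap_of_disjoint List.nodup_range' (fun i _ => ?_) fun i _ i' _ x h h' => ?_
  · split_ifs <;> simp
  · rw [Option.mem_toList] at h h'
    split_ifs at h h'
    simp only [Option.some.injEq] at h h'
    exact (triple_inj (h.trans h'.symm)).1

/-- A pair `(u, v)` with `v = L.easy u` is emitted in the summation or in row 0 according to the
parity of `u`, and every other pair in row `u + 1`. Thus the three sources of output are disjoint
and exhaustive. -/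
theorem isNoSelfAPSD_output (L : AdjLists G) (hn : 2 ≤ n) :
    IsNoSelfAPSD G (sumFrom L 0 ++ rowsFrom L 0) := by
  have hmem : ∀ {x}, x ∈ rowsFrom L 1 ↔
      ∃ s < n, ∃ i < n, ¬ (i = s ∨ i = L.easy s) ∧ x = triple G s i := by
    intro x
    simp only [rowsFrom, List.mem_flatMap, List.mem_range'_1]
    constructor
    · rintro ⟨r, hr, hx⟩
      obtain ⟨s, rfl⟩ : ∃ s, r = s + 1 := ⟨r - 1, by omega⟩
      exact ⟨s, by omega, mem_rowFrom_succ.1 hx⟩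
    · rintro ⟨s, hs, hx⟩
      exact ⟨s + 1, by omega, mem_rowFrom_succ.2 hx⟩
  have hnodup : (rowsFrom L 1).Nodup := by
    refine nodup_flatMap_of_disjoint List.nodup_range' (fun r _ => nodup_rowFrom r)
      fun r hr r' hr' x hx hx' => ?_
    rw [List.mem_range'_1] at hr hr'
    obtain ⟨s, rfl⟩ : ∃ s, r = s + 1 := ⟨r - 1, by omega⟩
    obtain ⟨s', rfl⟩ : ∃ s', r' = s' + 1 := ⟨r' - 1, by omega⟩
    obtain ⟨i, -, -, rfl⟩ := mem_rowFrom_succ.1 hx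
    obtain ⟨i', -, -, e⟩ := mem_rowFrom_succ.1 hx'
    rw [(triple_inj e).1]
  rw [rowsFrom_eq (Nat.zero_le n)]
  constructor
  · refine List.nodup_append'.2 ⟨nodup_sumFrom, List.nodup_append'.2 ⟨nodup_rowFrom 0, hnodup, ?_⟩,
      ?_⟩
    · intro x hx hx'
      obtain ⟨i, -, -, rfl⟩ := mem_rowFrom_zero.1 hx
      obtain ⟨s, -, j, -, hj, e⟩ := hmem.1 hx'
      obtain ⟨rfl, rfl⟩ := triple_inj e
      exact hj (.inr rfl)
    · intro x hx hx'
      obtain ⟨i, -, hi, rfl⟩ := mem_sumFrom.1 hx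
      rcases List.mem_append.1 hx' with hx' | hx'
      · obtain ⟨j, -, hj, e⟩ := mem_rowFrom_zero.1 hx'
        obtain ⟨rfl, -⟩ := triple_inj e
        omega
      · obtain ⟨s, -, j, -, hj, e⟩ := hmem.1 hx'
        obtain ⟨rfl, rfl⟩ := triple_inj e
        exact hj (.inr rfl)
  · intro x
    have htriple : ∀ u v : Fin n, triple G u v = ((u : ℕ), (v : ℕ), dist G u v) := fun u v => by
      simp [triple, distN]
    simp only [List.mem_append, mem_sumFrom, mem_rowFrom_zero, hmem]
    constructor
    · have easy : ∀ i < n, x = triple G i (L.easy i) →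
          ∃ u v : Fin n, u ≠ v ∧ x = ((u : ℕ), (v : ℕ), dist G u v) := by
        intro i hi hx
        obtain ⟨h1, h2, -⟩ := L.easy_spec hi hn
        exact ⟨⟨i, hi⟩, ⟨_, h1⟩, fun e => h2 (congrArg Fin.val e).symm, by rw [hx, ← htriple]⟩
      rintro (⟨i, hi, -, hx⟩ | ⟨i, hi, -, hx⟩ | ⟨s, hs, i, hi, hne, hx⟩)
      · exact easy i hi hx
      · exact easy i hi hx
      · exact ⟨⟨s, hs⟩, ⟨i, hi⟩, fun e => hne (.inl (congrArg Fin.val e).symm),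
          by rw [hx, ← htriple]⟩
    · rintro ⟨u, v, hne, hx⟩
      rw [← htriple] at hx
      by_cases he : (v : ℕ) = L.easy u
      · rw [he] at hx
        rcases Nat.mod_two_eq_zero_or_one u with h | h
        · exact .inl ⟨u, u.is_lt, h, hx⟩
        · exact .inr (.inl ⟨u, u.is_lt, h, hx⟩)
      · exact .inr (.inr ⟨u, u.is_lt, v, v.is_lt,
          fun h => h.elim (fun e => hne (Fin.ext e.symm)) he, hx⟩)

theorem isNoSelfAPSD_nil {G : Digraph (Fin 1)} : IsNoSelfAPSD G [] :=
  ⟨List.nodup_nil, fun x => by simp⟩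

/-- The program accesses the first cell of the queue. -/
theorem le_space_enumProgram (hw : 4 * n + 4 ≤ 2 ^ w) (hn : 2 ≤ n) (mem₀ : ℕ → ℕ) :
    (n : ℕ∞) ≤ enumProgram.space w L (enumProgram.init mem₀) := by
  have h1 : 1 < 2 ^ w := by omega
  have h2 : n + n < 2 ^ w := by omega
  have h3 : n ≠ 1 := by omega
  let ρ₁ : Reg → ℕ := Function.update (fun _ => 0) .n n
  let ρ₂ := Function.update ρ₁ .one 1
  let ρ₃ := Function.update ρ₂ .nxt n
  let ρ₄ := Function.update ρ₃ .que (n + n)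
  have hr : ∃ c, enumProgram.Reaches w L (enumProgram.init mem₀) c ∧
      enumProgram.access c = some (n + n) := by
    -- The sixth instruction stores at address 2n; this single access gives the linear lower bound.
    refine ⟨⟨.source, ρ₄, mem₀⟩, .head (b := ⟨.one, ρ₁, mem₀⟩) (.inl rfl)
      (.head (b := ⟨.ifTrivial, ρ₂, mem₀⟩) (.inl ?_) (.head (b := ⟨.nxt, ρ₂, mem₀⟩) (.inl ?_)
      (.head (b := ⟨.que, ρ₃, mem₀⟩) (.inl rfl) (.single (.inl ?_))))), rfl⟩
    · simp [step, enumProgram, ρ₂, Nat.mod_eq_of_lt h1]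
    · simp [step, enumProgram, ρ₂, ρ₁, h3]
    · simp [step, enumProgram, ρ₄, ρ₃, ρ₂, ρ₁, Nat.mod_eq_of_lt h2]
  refine le_trans ?_ le_add_self
  refine le_trans ?_ (le_iSup₂ (n + n) hr)
  exact_mod_cast (by omega : n ≤ n + n + 1)

end Main

end APSDEnum

theorem mainTheorem5 :
    ∃ (Q R : Type) (_ : Fintype Q) (_ : Fintype R) (_ : DecidableEq R)
      (M : APSDEnum.Program Q R) (k C A B : ℕ), 1 ≤ k ∧
      ∀ (n : ℕ), 1 ≤ n → ∀ (G : Digraph (Fin n)) (L : APSDEnum.AdjLists G)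
        -- word size `w ≥ k * log₂ (n + 1)`, memory initially filled with arbitrary words
        (w : ℕ), (n + 1) ^ k ≤ 2 ^ w → ∀ mem₀ : ℕ → ℕ, (∀ a, mem₀ a < 2 ^ w) →
        (∃ out : List APSDEnum.Output, APSDEnum.IsNoSelfAPSD G out ∧
          M.EmitsWithDelay w L (C * (APSDEnum.avgDegree G + 1)) (M.init mem₀) out) ∧
        M.space w L (M.init mem₀) ≤ (A : ℕ∞) * n ∧
        (n : ℕ∞) ≤ (B : ℕ∞) * M.space w L (M.init mem₀) := by
  refine ⟨APSDEnum.Pos, APSDEnum.Reg, inferInstance, inferInstance, inferInstance,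
    -- Exponent 3 makes words exceed all addresses and `n * n`, which bounds the degree sum. The
    -- delay 16 · (22 · (m/n) + 93) is at most 1488 · (m/n + 1), as 1488 = 16 · 93. The space 25 +
    -- 3n + 1 is at most 29n.
    APSDEnum.enumProgram, 3, 1488, 29, 1, by norm_num, fun n hn G L w hw mem₀ _ => ?_⟩
  have hcard : Fintype.card APSDEnum.Reg = 25 := rfl
  have havg : (L.edges / n : ℕ) ≤ APSDEnum.avgDegree G := by
    rw [L.avgDegree_eq]; exact Nat.cast_div_le
  have hw1 : 4 * (n + 1) ≤ 2 ^ w := by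
    have : 2 ^ 2 ≤ (n + 1) ^ 2 := Nat.pow_le_pow_left (by omega) 2
    rw [pow_succ] at hw
    exact le_trans (Nat.mul_le_mul_right _ this) hw
  have hw2 : n * n < 2 ^ w := by nlinarith [Nat.zero_le n]
  rcases Nat.lt_or_ge n 2 with h1 | h2
  · obtain rfl : n = 1 := by omega
    -- For n = 1 there is nothing to emit: four steps and no memory access, so the registers alone
    -- provide both space bounds.
    have hrun : APSDEnum.Program.RunsWithin APSDEnum.enumProgram w L 0 4 4
        (APSDEnum.enumProgram.init mem₀) [] := by
      refine .size rfl (.const rfl (by omega) (.ifEq rfl (fun _ => .halted rfl)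
        fun e => absurd ?_ e))
      simp
    refine ⟨⟨[], APSDEnum.isNoSelfAPSD_nil, hrun.emitsWithDelay ?_⟩, ?_, ?_⟩
    · have : (0 : ℝ) ≤ APSDEnum.avgDegree G := le_trans (Nat.cast_nonneg _) havg
      push_cast
      linarith
    · refine hrun.space_le.trans ?_
      rw [hcard]
      norm_num
    · rw [Nat.cast_one, one_mul, APSDEnum.Program.space, hcard]
      exact le_trans (by norm_num) le_self_add
  · have hrun := APSDEnum.runs_enumProgram (L := L) (S := 3 * n) le_rfl (by omega) hw2 h2 le_rfl
      mem₀
    refine ⟨⟨_, APSDEnum.isNoSelfAPSD_output L h2, hrun.emitsWithDelay ?_⟩, ?_, ?_⟩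
    · have e : L.itemTime = 22 * (L.edges / n) + 93 := by
        simp only [APSDEnum.AdjLists.itemTime, APSDEnum.AdjLists.quota]; ring
      rw [e]
      push_cast
      have : (0 : ℝ) ≤ APSDEnum.avgDegree G := le_trans (Nat.cast_nonneg _) havg
      linarith
    · refine hrun.space_le.trans ?_
      rw [hcard]
      exact_mod_cast (by omega : 25 + (3 * n + 1) ≤ 29 * n)
    · rw [Nat.cast_one, one_mul]
      exact APSDEnum.le_space_enumProgram (by omega) h2 mem₀
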